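/- Let $d\ge 2$ be an integer, let $p^*=\infty$ if $d=2$ and $p^*=\frac{d}{d-2}$ if $d\ge3$, and let $1<p<p^*$. Let $\eta\in C^\infty(\mathbb R)$ satisfy $\eta'\le 0$ on $\mathbb R$, $\eta=1$ on $(-\infty,0]$ and $\eta=0$ on $[1,\infty)$. Let $$d\mu(\zeta)=\rho(\zeta)\,d\zeta,\qquad \rho(\zeta)=\exp\Big\{\tfrac{e^{2\zeta}}{4}-\Big(\tfrac{p+3}{p-1}-d+1\Big)\zeta\Big\},$$ and let $H^1(\mathbb R,d\mu)$ be the completion of $C_c^\infty(\mathbb R)$ with respect to the norm given by $\|w\|^2=\int_{\mathbb R}\big(|w'|^2+|w|^2\big)\,d\mu$. Consider the equation $$\phi''+\Big(\frac{e^{2\zeta}}{2}-\frac{p+3}{p-1}+d-1\Big)\phi'+\frac{2}{p-1}\Big(\frac{p+1}{p-1}-d+1\Big)(\phi-\phi^p)=0,\qquad \zeta\in\mathbb R. \tag{1}$$ Then there exists a unique (up to equality almost everywhere) weak solution $\phi\in H^1_{loc}(\mathbb R)$ of (1) such that $\phi-\eta\in H^1(\mathbb R,d\mu)$ and $0\le\phi\le1$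 almost everywhere. Moreover, after modification on a null set, $\phi\in C^\infty(\mathbb R)$, $\phi$ satisfies (1) classically, $0<\phi<1$ on $\mathbb R$, $\phi$ is strictly decreasing, $$\lim_{\zeta\to-\infty}\phi(\zeta)=1,\qquad \lim_{\zeta\to+\infty}\phi(\zeta)=0,\qquad \lim_{\zeta\to\pm\infty}\phi'(\zeta)=0,$$ and there is a constant $C>0$ such that $$\lim_{\zeta\to+\infty}\phi(\zeta)\,\exp\Big\{\tfrac{e^{2\zeta}}{4}-\Big(\tfrac{5-p}{p-1}-d+1\Big)\zeta\Big\}=C.$$ Finally, let $$U(x,t)=v_\infty(x)\,\phi\Big(\ln\frac{|x|}{\sqrt t}\Big),\qquad v_\infty(x)=\Big[\tfrac{2}{p-1}\Big(\tfrac{2p}{p-1}-d\Big)\Big]^{\frac1{p-1}}|x|^{-\frac{2}{p-1}},$$ for $x\in\mathbb R^d\setminus\{0\}$ and $t>0$. Then $U$ is an ultra-singular self-similar solution: $U$ is positive and of class $C^2$ on $(\mathbb R^d\setminus\{0\})\times(0,\infty)$, satisfies $U_t=\Delta U-U^p$ there, $\lim_{t\to0^+}U(x,t)=0$ for every $x\ne0$,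 $\lim_{|x|\to0}|x|^{\frac2{p-1}}U(x,t)$ exists and is positive for every $t>0$, and $|x|^{\frac{2}{p-1}}U(x,t)$ is a function of $\ln(|x|/\sqrt t)$ only. -/

import Mathlib

open MeasureTheory Filter Topology Laplacian
open scoped ContDiff

namespace UltraSingular

noncomputable section

/-- The Serrin critical exponent `p*`: `∞` for `d = 2`, and `d / (d - 2)` for `d ≥ 3`
(it is only used for `d ≥ 2`). -/
def serrinExponent (d : ℕ) : EReal :=
  if d = 2 then ⊤ else (((d : ℝ) / ((d : ℝ) - 2) : ℝ) : EReal)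

/-- The coefficient `e^{2ζ}/2 - (p+3)/(p-1) + d - 1` of `φ'` in the profile equation. -/
def driftCoeff (d : ℕ) (p ζ : ℝ) : ℝ :=
  Real.exp (2 * ζ) / 2 - (p + 3) / (p - 1) + (d : ℝ) - 1

/-- The coefficient `2/(p-1) * ((p+1)/(p-1) - d + 1)` of `φ - φ^p` in the profile equation. -/
def reactionCoeff (d : ℕ) (p : ℝ) : ℝ :=
  2 / (p - 1) * ((p + 1) / (p - 1) - (d : ℝ) + 1)

/-- The weight `ρ(ζ) = exp(e^{2ζ}/4 - ((p+3)/(p-1) - d + 1) ζ)`. -/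
def weight (d : ℕ) (p ζ : ℝ) : ℝ :=
  Real.exp (Real.exp (2 * ζ) / 4 - ((p + 3) / (p - 1) - (d : ℝ) + 1) * ζ)

/-- The measure `dμ = ρ dζ` on the real line. -/
def weightedMeasure (d : ℕ) (p : ℝ) : Measure ℝ :=
  volume.withDensity (fun ζ => ENNReal.ofReal (weight d p ζ))

/-- Test functions: smooth functions with compact support on the real line. -/
def IsTest (w : ℝ → ℝ) : Prop :=
  ContDiff ℝ ∞ w ∧ HasCompactSupport w

/-- Membership in `H¹(ℝ, dμ)`, the completion of the test functions with respect to the norm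
`(‖w'‖²_{L²(μ)} + ‖w‖²_{L²(μ)})^{1/2}`: a function `w ∈ L²(μ)` belongs to it if some sequence of
test functions converges to `w` in `L²(μ)` while the derivatives converge in `L²(μ)` as well. -/
def MemWeightedH1 (μ : Measure ℝ) (w : ℝ → ℝ) : Prop :=
  ∃ g : ℝ → ℝ, MemLp w 2 μ ∧ MemLp g 2 μ ∧
    ∃ s : ℕ → ℝ → ℝ, (∀ n, IsTest (s n)) ∧
      Tendsto (fun n => eLpNorm (fun ζ => s n ζ - w ζ) 2 μ) atTop (𝓝 0) ∧
      Tendsto (fun n => eLpNorm (fun ζ => deriv (s n) ζ - g ζ) 2 μ) atTop (𝓝 0)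

/-- Membership in `L²_loc(ℝ)`. -/
def MemL2Loc (f : ℝ → ℝ) : Prop :=
  ∀ K : Set ℝ, IsCompact K → MemLp f 2 (volume.restrict K)

/-- `g` is the weak derivative of `f` on the real line. -/
def IsWeakDeriv (f g : ℝ → ℝ) : Prop :=
  ∀ w : ℝ → ℝ, IsTest w → ∫ ζ, f ζ * deriv w ζ = -∫ ζ, g ζ * w ζ

/-- `φ ∈ H¹_loc(ℝ)` is a weak solution of
`φ'' + (e^{2ζ}/2 - (p+3)/(p-1) + d - 1) φ' + 2/(p-1) ((p+1)/(p-1) - d + 1) (φ - φ^p) = 0`. -/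
def IsWeakSolution (d : ℕ) (p : ℝ) (φ : ℝ → ℝ) : Prop :=
  ∃ g : ℝ → ℝ, MemL2Loc φ ∧ MemL2Loc g ∧ IsWeakDeriv φ g ∧
    ∀ w : ℝ → ℝ, IsTest w →
      ∫ ζ, (-(g ζ * deriv w ζ) + driftCoeff d p ζ * g ζ * w ζ
        + reactionCoeff d p * (φ ζ - φ ζ ^ p) * w ζ) = 0

/-- The cut-off functions `η`: smooth, nonincreasing, equal to `1` on `(-∞, 0]` and to `0` on
`[1, ∞)`. -/
structure IsCutoff (η : ℝ → ℝ) : Prop where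
  smooth : ContDiff ℝ ∞ η
  deriv_nonpos : ∀ ζ, deriv η ζ ≤ 0
  eq_one : ∀ ζ, ζ ≤ 0 → η ζ = 1
  eq_zero : ∀ ζ, 1 ≤ ζ → η ζ = 0

/-- The class of functions in which the self-similar profile is unique: weak solutions `φ` of the
profile equation with `φ - η ∈ H¹(ℝ, dμ)` and `0 ≤ φ ≤ 1` (almost everywhere, as elements of
`H¹_loc(ℝ)` are functions modulo null sets). -/
structure IsAdmissibleProfile (d : ℕ) (p : ℝ) (η φ : ℝ → ℝ) : Prop where
  weak : IsWeakSolution d p φ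
  mem : MemWeightedH1 (weightedMeasure d p) (fun ζ => φ ζ - η ζ)
  bounds : ∀ᵐ ζ, 0 ≤ φ ζ ∧ φ ζ ≤ 1

/-- The function `v_∞(x) = c(p,d) |x|^{-2/(p-1)}` with
`c(p,d) = (2/(p-1) (2p/(p-1) - d))^{1/(p-1)}`. -/
def vInfty (d : ℕ) (p : ℝ) (x : EuclideanSpace ℝ (Fin d)) : ℝ :=
  (2 / (p - 1) * (2 * p / (p - 1) - (d : ℝ))) ^ (1 / (p - 1)) / ‖x‖ ^ (2 / (p - 1))

/-- Ultra-singular solutions `U : (ℝ^d \ {0}) × (0, ∞) → (0, ∞)` of `U_t = ΔU - U^p`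
(the values of `U` elsewhere are irrelevant). -/
structure IsUltraSingular (d : ℕ) (p : ℝ) (U : EuclideanSpace ℝ (Fin d) → ℝ → ℝ) : Prop where
  pos : ∀ x t, x ≠ 0 → 0 < t → 0 < U x t
  regular : ContDiffOn ℝ 2 (fun z : EuclideanSpace ℝ (Fin d) × ℝ => U z.1 z.2)
    {z | z.1 ≠ 0 ∧ 0 < z.2}
  equation : ∀ x t, x ≠ 0 → 0 < t →
    deriv (fun s => U x s) t = (Δ (fun y => U y t)) x - U x t ^ p
  initial : ∀ x, x ≠ 0 → Tendsto (fun t => U x t) (𝓝[>] 0) (𝓝 0)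
  singular : ∀ t, 0 < t → ∃ L : ℝ, 0 < L ∧
    Tendsto (fun x => ‖x‖ ^ (2 / (p - 1)) * U x t) (𝓝[≠] 0) (𝓝 L)

/-- Self-similarity: `|x|^{2/(p-1)} U(x,t)` is a function of the similarity variable
`ζ = ln(|x|/√t)` only. -/
def IsSelfSimilar (d : ℕ) (p : ℝ) (U : EuclideanSpace ℝ (Fin d) → ℝ → ℝ) : Prop :=
  ∃ f : ℝ → ℝ, ∀ x t, x ≠ 0 → 0 < t →
    ‖x‖ ^ (2 / (p - 1)) * U x t = f (Real.log (‖x‖ / √t))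

end

end UltraSingular

/-!
With `ρ` the weight and `M = -ρ φ'` the flux, the profile equation is the first order system
`φ' = -M / ρ`, `M' = ρ κ (φ - φ^p)`, where `κ > 0` below the critical exponent. For `0 ≤ φ ≤ 1` the
right-hand side of the second equation is nonnegative: the flux is monotone, and nearly everything
follows from this.

*Existence* (`exists_isProfile`). With the reaction term truncated outside `[0, 1]`, the system has
global solutions depending continuously on the data. Shooting from `-n` gives a solution on
`[-n, n]` with boundary values `1` and `0`, nonincreasing since its flux is nonnegative. The data
at `0` of these solutions are bounded, so that a subsequence converges locally. Two explicit
barriers, independent of `n`, keep the limit from being constant: `1 - φ ≲ e^{mζ/2}` near `-∞` and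
`φ ≲ e^{-ζ} / ρ` near `+∞`, with `m = (p+3)/(p-1) - d + 1 > 0`.

*Behaviour at infinity.* Of the condition `φ - η ∈ H¹(μ)` only two consequences are needed: `φ`
comes arbitrarily close to `1` near `-∞`, and drops below every multiple of `e^{-2ζ}` near `+∞`
(`IsProfile`). The flux tends to `0` at `-∞`, since otherwise `1 - φ` would be comparable to `1 / ρ`
and `M'` would stay away from `0`. For large `ζ`, the function `φ' + (e^{2ζ}/2 - m) φ / 2` is
nondecreasing and cannot become positive; thus `ρ φ ≤ 8 e^{-2ζ} M`, and by Grönwall's inequality `M`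
has a finite limit, which is positive. L'Hôpital's rule turns it into the asymptotics of `φ`
(`IsProfile.exists_tendsto_div`).

*Uniqueness* (`IsProfile.unique`). The Wronskian `ρ (φ' ψ - ψ' φ)` of two profiles vanishes at `±∞`
and is increasing wherever `φ > ψ`, as `(u - u^p) / u` decreases in `u`. According to its sign at a
point where `φ > ψ`, the ratio `φ / ψ` stays above `1` to the right or to the left of that point,
so that the Wronskian is monotone there and cannot tend to `0`: a contradiction.

*Weak solutions.* A function with vanishing weak derivative is constant (du Bois-Reymond), so a weak
solution solves the first order system after modification on a null set
(`IsAdmissibleProfile.exists_isProfile`). Conversely `1 / ρ` is integrable and dominates `φ - η` and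
its derivative, which therefore belong to `L²(μ)` and are limits of cut-offs
(`IsProfile.isAdmissibleProfile`).

*The solution `U`.* In the variables `log |x|` and `log t` the equation `U_t = ΔU - U^p` becomes the
profile equation (`selfSimilar_equation`), by the formula for radial Laplacians.
-/

namespace UltraSingular

noncomputable section

/-! ### Global flows of locally bounded Lipschitz fields -/

/-- Two-sided Grönwall estimate: the distance of two solutions grows at most exponentially, both
forwards and backwards in time. -/
theorem dist_le_of_trajectories {E : Type*} [NormedAddCommGroup E] [NormedSpace ℝ E]
    {V : ℝ → E → E} {T : ℝ} {K : NNReal}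
    (hV : ∀ t ∈ Set.Icc (-T) T, LipschitzWith K (V t)) {f g : ℝ → E}
    (hf : ∀ t, HasDerivAt f (V t (f t)) t) (hg : ∀ t, HasDerivAt g (V t (g t)) t)
    {s t : ℝ} (hs : s ∈ Set.Icc (-T) T) (ht : t ∈ Set.Icc (-T) T) :
    dist (f t) (g t) ≤ dist (f s) (g s) * Real.exp (K * |t - s|) := by
  rcases le_total s t with h | h
  · have := dist_le_of_trajectories_ODE_of_mem (v := V) (K := K) (s := fun _ => Set.univ)
      (a := s) (b := t) (f := f) (g := g) (δ := dist (f s) (g s))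
      (fun r hr => (hV r ⟨hs.1.trans hr.1, hr.2.le.trans ht.2⟩).lipschitzOnWith)
      (fun r _ => (hf r).continuousAt.continuousWithinAt)
      (fun r _ => (hf r).hasDerivWithinAt) (fun _ _ => trivial)
      (fun r _ => (hg r).continuousAt.continuousWithinAt)
      (fun r _ => (hg r).hasDerivWithinAt) (fun _ _ => trivial) le_rfl t ⟨h, le_rfl⟩
    rwa [abs_of_nonneg (sub_nonneg.2 h)]
  · have hf' : ∀ r, HasDerivAt (fun r => f (-r)) (-(V (-r) (f (-r)))) r := fun r => by
      simpa [Function.comp_def] using (hf (-r)).scomp r (hasDerivAt_neg r)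
    have hg' : ∀ r, HasDerivAt (fun r => g (-r)) (-(V (-r) (g (-r)))) r := fun r => by
      simpa [Function.comp_def] using (hg (-r)).scomp r (hasDerivAt_neg r)
    have := dist_le_of_trajectories_ODE_of_mem (v := fun r x => -V (-r) x) (K := K)
      (s := fun _ => Set.univ)
      (a := -s) (b := -t) (f := fun r => f (-r)) (g := fun r => g (-r)) (δ := dist (f s) (g s))
      (fun r hr =>
        ((hV (-r) ⟨by linarith [hr.2, ht.1], by linarith [hr.1, hs.2]⟩).neg).lipschitzOnWith)
      (fun r _ => (hf' r).continuousAt.continuousWithinAt)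
      (fun r _ => (hf' r).hasDerivWithinAt) (fun _ _ => trivial)
      (fun r _ => (hg' r).continuousAt.continuousWithinAt)
      (fun r _ => (hg' r).hasDerivWithinAt) (fun _ _ => trivial) (by simp) (-t)
      ⟨by linarith, le_rfl⟩
    rw [abs_of_nonpos (sub_nonpos.2 h)]
    simpa [neg_sub, add_comm, sub_eq_add_neg] using this

/-- Global Picard-Lindelöf theorem for fields that are bounded and Lipschitz, uniformly on bounded
time intervals. The bound allows the local theorem to cover a whole interval `[-T, T]` at once. -/
theorem exists_global_trajectory {E : Type*} [NormedAddCommGroup E] [NormedSpace ℝ E]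
    [CompleteSpace E] {V : ℝ → E → E} (hc : ∀ x, Continuous fun t => V t x)
    (hL : ∀ T, ∃ K : NNReal, ∀ t ∈ Set.Icc (-T) T, LipschitzWith K (V t))
    (hB : ∀ T, ∃ L : NNReal, ∀ t ∈ Set.Icc (-T) T, ∀ x, ‖V t x‖ ≤ L) (t₀ : ℝ) (x₀ : E) :
    ∃ f : ℝ → E, f t₀ = x₀ ∧ ∀ t, HasDerivAt f (V t (f t)) t := by
  have hloc : ∀ T, |t₀| < T → ∃ f : ℝ → E, f t₀ = x₀ ∧
      ∀ t ∈ Set.Ioo (-T) T, HasDerivAt f (V t (f t)) t := by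
    intro T hT
    obtain ⟨K, hK⟩ := hL T
    obtain ⟨L, hL⟩ := hB T
    have ht₀ : t₀ ∈ Set.Icc (-T) T := abs_le.1 hT.le
    have hT0 : 0 ≤ T := (abs_nonneg _).trans hT.le
    have hPL : IsPicardLindelof V (⟨t₀, ht₀⟩ : Set.Icc (-T) T) x₀
        (L * Real.toNNReal (2 * T)) 0 L K :=
      { lipschitzOnWith := fun t ht => (hK t ht).lipschitzOnWith
        continuousOn := fun x _ => (hc x).continuousOn
        norm_le := fun t ht x _ => hL t ht x
        mul_max_le := by
          simp only [NNReal.coe_mul, NNReal.coe_zero, sub_zero]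
          rw [Real.coe_toNNReal _ (by linarith)]
          gcongr
          rw [max_le_iff]
          exact ⟨by linarith [ht₀.1], by linarith [ht₀.2]⟩ }
    obtain ⟨f, hf0, hf⟩ := hPL.exists_eq_forall_mem_Icc_hasDerivWithinAt₀
    exact ⟨f, hf0, fun t ht => (hf t (Set.Ioo_subset_Icc_self ht)).hasDerivAt
      (Icc_mem_nhds ht.1 ht.2)⟩
  choose! g hg0 hg using hloc
  -- the local solutions agree wherever two of them are defined
  have hagree : ∀ S T, |t₀| < S → S ≤ T → Set.EqOn (g S) (g T) (Set.Ioo (-S) S) := by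
    intro S T hS hST
    obtain ⟨K, hK⟩ := hL S
    exact ODE_solution_unique_of_mem_Ioo (v := V) (K := K) (s := fun _ => Set.univ)
      (fun t ht => (hK t (Set.Ioo_subset_Icc_self ht)).lipschitzOnWith) (abs_lt.1 hS)
      (fun t ht => ⟨hg S hS t ht, trivial⟩)
      (fun t ht => ⟨hg T (hS.trans_le hST) t ⟨by linarith [ht.1], by linarith [ht.2]⟩, trivial⟩)
      ((hg0 S hS).trans (hg0 T (hS.trans_le hST)).symm)
  refine ⟨fun t => g (|t| + |t₀| + 1) t, hg0 _ (by linarith [abs_nonneg t₀]), fun t => ?_⟩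
  have hT : |t₀| < |t| + |t₀| + 2 := by linarith [abs_nonneg t]
  have key : ∀ s, |s| < |t| + 1 → g (|s| + |t₀| + 1) s = g (|t| + |t₀| + 2) s := fun s hs =>
    hagree _ _ (by linarith [abs_nonneg s]) (by linarith)
      (abs_lt.1 (by linarith [abs_nonneg t₀]))
  have h1 := hg _ hT t (abs_lt.1 (by linarith [abs_nonneg t₀]))
  beta_reduce
  rw [key t (by linarith)]
  refine h1.congr_of_eventuallyEq ?_
  have : ∀ᶠ s in 𝓝 t, |s| < |t| + 1 :=
    continuous_abs.continuousAt.eventually_lt continuousAt_const (by linarith)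
  filter_upwards [this] with s hs using key s hs

/-! ### The profile equation as a first order system -/

/-- The weight `exp (e^{2ζ}/4 - m ζ)`; `weight d p` is the case `m = (p+3)/(p-1) - d + 1`. -/
def expWeight (m ζ : ℝ) : ℝ := Real.exp (Real.exp (2 * ζ) / 4 - m * ζ)

theorem expWeight_pos (m ζ : ℝ) : 0 < expWeight m ζ := Real.exp_pos _

theorem contDiff_expWeight (m : ℝ) {n : WithTop ℕ∞} : ContDiff ℝ n (expWeight m) := by
  unfold expWeight; fun_prop

theorem continuous_expWeight (m : ℝ) : Continuous (expWeight m) := by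
  unfold expWeight; fun_prop

theorem hasDerivAt_expWeight (m ζ : ℝ) :
    HasDerivAt (expWeight m) (expWeight m ζ * (Real.exp (2 * ζ) / 2 - m)) ζ := by
  have h2 : HasDerivAt (fun ζ : ℝ => 2 * ζ) 2 ζ := by simpa using (hasDerivAt_id ζ).const_mul 2
  have hm : HasDerivAt (fun ζ : ℝ => m * ζ) m ζ := by simpa using (hasDerivAt_id ζ).const_mul m
  have := ((h2.exp.div_const 4).sub hm).exp
  refine this.congr_deriv ?_
  simp only [expWeight, Pi.sub_apply]
  ring

theorem inv_expWeight (m ζ : ℝ) :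
    (expWeight m ζ)⁻¹ = Real.exp (-(Real.exp (2 * ζ) / 4) + m * ζ) := by
  rw [expWeight, ← Real.exp_neg]; congr 1; ring

/-- A common bound of `expWeight m` and of its inverse on `[-T, T]`. -/
def weightBound (m T : ℝ) : ℝ := Real.exp (Real.exp (2 * T) / 4 + |m| * T)

theorem expWeight_le_weightBound {m T t : ℝ} (ht : |t| ≤ T) :
    expWeight m t ≤ weightBound m T := by
  unfold expWeight weightBound
  have h1 : -(m * t) ≤ |m| * T := (neg_le_abs _).trans (by rw [abs_mul]; gcongr)
  have h2 : Real.exp (2 * t) ≤ Real.exp (2 * T) := by gcongr; exact (le_abs_self t).trans ht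
  gcongr
  linarith

theorem inv_expWeight_le_weightBound {m T t : ℝ} (ht : |t| ≤ T) :
    (expWeight m t)⁻¹ ≤ weightBound m T := by
  rw [inv_expWeight]
  unfold weightBound
  have h1 : m * t ≤ |m| * T := (le_abs_self _).trans (by rw [abs_mul]; gcongr)
  have h2 := Real.exp_pos (2 * t)
  have h3 := Real.exp_pos (2 * T)
  gcongr
  linarith

/-- Truncation to the unit interval. -/
def clip (u : ℝ) : ℝ := max 0 (min u 1)

theorem clip_mem (u : ℝ) : clip u ∈ Set.Icc (0 : ℝ) 1 :=
  ⟨le_max_left _ _, max_le zero_le_one (min_le_right _ _)⟩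

theorem clip_of_mem {u : ℝ} (h0 : 0 ≤ u) (h1 : u ≤ 1) : clip u = u := by
  rw [clip, min_eq_left h1, max_eq_right h0]

theorem lipschitzWith_clip : LipschitzWith 1 clip :=
  (LipschitzWith.id.min_const 1).const_max 0

/-- The reaction term `κ (u - u^p)`, cut off outside `[0, 1]` so that it is bounded, nonnegative
and globally Lipschitz. -/
def reaction (κ p u : ℝ) : ℝ := κ * (clip u - clip u ^ p)

theorem reaction_of_mem {κ p u : ℝ} (h0 : 0 ≤ u) (h1 : u ≤ 1) :
    reaction κ p u = κ * (u - u ^ p) := by rw [reaction, clip_of_mem h0 h1]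

theorem reaction_nonneg {κ p : ℝ} (hκ : 0 ≤ κ) (hp : 1 ≤ p) (u : ℝ) : 0 ≤ reaction κ p u := by
  obtain ⟨h0, h1⟩ := clip_mem u
  exact mul_nonneg hκ (sub_nonneg.2 (Real.rpow_le_self_of_le_one h0 h1 hp))

theorem reaction_le {κ p : ℝ} (hκ : 0 ≤ κ) (u : ℝ) : reaction κ p u ≤ κ := by
  obtain ⟨h0, h1⟩ := clip_mem u
  have := Real.rpow_nonneg h0 p
  unfold reaction
  nlinarith

theorem exists_lipschitzWith_reaction {κ p : ℝ} (hp : 1 ≤ p) :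
    ∃ K : NNReal, LipschitzWith K (reaction κ p) := by
  have h1 : LipschitzOnWith (Real.toNNReal p) (fun x : ℝ => x ^ p) (Set.Icc 0 1) := by
    refine (convex_Icc (0 : ℝ) 1).lipschitzOnWith_of_nnnorm_hasDerivWithin_le
      (f' := fun x => p * x ^ (p - 1))
      (fun x _ => (Real.hasDerivAt_rpow_const (Or.inr hp)).hasDerivWithinAt) ?_
    intro x hx
    rw [← NNReal.coe_le_coe, coe_nnnorm, Real.coe_toNNReal _ (by linarith), Real.norm_eq_abs,
      abs_of_nonneg (mul_nonneg (by linarith) (Real.rpow_nonneg hx.1 _))]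
    have := Real.rpow_le_one hx.1 hx.2 (sub_nonneg.2 hp)
    nlinarith
  have h2 : LipschitzWith (Real.toNNReal p * 1) (fun u => clip u ^ p) := by
    have := h1.comp (lipschitzWith_clip.lipschitzOnWith (s := Set.univ))
      (fun u _ => clip_mem u)
    exact lipschitzOnWith_univ.1 this
  exact ⟨_, (lipschitzWith_smul κ).comp (lipschitzWith_clip.sub h2)⟩

/-- The pair `(φ, M)` solves `φ' = -M / ρ`, `M' = ρ F(φ)`, where `ρ = expWeight m` and `F` is the
truncated reaction term: this is `(ρ φ')' + ρ F(φ) = 0` with the flux `M = -ρ φ'` as second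
unknown. -/
structure IsFlow (m κ p : ℝ) (φ M : ℝ → ℝ) : Prop where
  left : ∀ ζ, HasDerivAt φ (-(M ζ / expWeight m ζ)) ζ
  right : ∀ ζ, HasDerivAt M (expWeight m ζ * reaction κ p (φ ζ)) ζ

/-- The vector field of the first order system. -/
def flowField (m κ p t : ℝ) (x : ℝ × ℝ) : ℝ × ℝ :=
  (-(x.2 / expWeight m t), expWeight m t * reaction κ p x.1)

theorem IsFlow.hasDerivAt_prodMk {m κ p : ℝ} {φ M : ℝ → ℝ} (h : IsFlow m κ p φ M) (t : ℝ) :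
    HasDerivAt (fun t => (φ t, M t)) (flowField m κ p t (φ t, M t)) t :=
  (h.left t).prodMk (h.right t)

theorem lipschitzWith_flowField {m κ p : ℝ} {K : NNReal} (hK : LipschitzWith K (reaction κ p))
    {T t : ℝ} (ht : t ∈ Set.Icc (-T) T) :
    LipschitzWith (Real.toNNReal (weightBound m T) * max 1 K) (flowField m κ p t) := by
  have ht' : |t| ≤ T := abs_le.2 ht
  have hb : 0 ≤ weightBound m T := (Real.exp_pos _).le
  refine LipschitzWith.of_dist_le_mul fun x y => ?_
  rw [Prod.dist_eq, NNReal.coe_mul, Real.coe_toNNReal _ hb]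
  have hK' := hK.dist_le_mul x.1 y.1
  have h1 : dist x.1 y.1 ≤ dist x y := le_max_left _ _
  have h2 : dist x.2 y.2 ≤ dist x y := le_max_right _ _
  have m1 : (1 : ℝ) ≤ ((max 1 K : NNReal) : ℝ) := by exact_mod_cast le_max_left _ _
  have m2 : (K : ℝ) ≤ ((max 1 K : NNReal) : ℝ) := by exact_mod_cast le_max_right _ _
  refine max_le ?_ ?_
  · have : dist (flowField m κ p t x).1 (flowField m κ p t y).1
        = (expWeight m t)⁻¹ * dist x.2 y.2 := by
      simp only [flowField, dist_neg_neg, Real.dist_eq]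
      rw [← sub_div, abs_div, abs_of_pos (expWeight_pos m t), div_eq_inv_mul]
    rw [this, mul_assoc]
    gcongr
    · exact inv_expWeight_le_weightBound ht'
    · nlinarith [dist_nonneg (x := x) (y := y)]
  · have : dist (flowField m κ p t x).2 (flowField m κ p t y).2
        = expWeight m t * dist (reaction κ p x.1) (reaction κ p y.1) := by
      simp only [flowField, Real.dist_eq]
      rw [← mul_sub, abs_mul, abs_of_pos (expWeight_pos m t)]
    rw [this, mul_assoc]
    gcongr
    · exact expWeight_le_weightBound ht'
    · exact hK'.trans (by gcongr)

/-- Global solvability for all data. As `M'` is bounded on bounded intervals, truncating `M` at an a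
priori bound does not change the solutions and makes the field bounded. -/
theorem exists_isFlow {m κ p : ℝ} (hκ : 0 ≤ κ) (hp : 1 ≤ p) (t₀ u₀ M₀ : ℝ) :
    ∃ φ M : ℝ → ℝ, φ t₀ = u₀ ∧ M t₀ = M₀ ∧ IsFlow m κ p φ M := by
  obtain ⟨K, hK⟩ := exists_lipschitzWith_reaction (κ := κ) hp
  -- an a priori bound of the flux, used to make the field bounded
  set B : ℝ → ℝ := fun t => |M₀| + weightBound m (|t| + |t₀|) * κ * |t - t₀| with hBdef
  have hBc : Continuous B := by
    simp only [hBdef, weightBound]; fun_prop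
  have hB0 : ∀ t, 0 ≤ B t := fun t => by
    have : 0 ≤ weightBound m (|t| + |t₀|) := (Real.exp_pos _).le
    positivity
  have htr : ∀ b : ℝ, LipschitzWith 1 fun x : ℝ => max (-b) (min x b) := fun b =>
    (LipschitzWith.id.min_const b).const_max (-b)
  have htrb : ∀ b : ℝ, 0 ≤ b → ∀ x : ℝ, |max (-b) (min x b)| ≤ b := fun b hb x =>
    abs_le.2 ⟨le_max_left _ _, max_le (by linarith) (min_le_right _ _)⟩
  obtain ⟨f, hf0, hf⟩ := exists_global_trajectory
    (V := fun t x => flowField m κ p t (x.1, max (-B t) (min x.2 (B t))))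
    (fun x => by
      have := continuous_expWeight m
      have h0 : ∀ t, expWeight m t ≠ 0 := fun t => (expWeight_pos m t).ne'
      simp only [flowField]
      fun_prop (disch := assumption))
    (fun T => ⟨_, fun t ht => by
      have h1 : LipschitzWith 1 (fun x : ℝ × ℝ => (x.1, max (-B t) (min x.2 (B t)))) := by
        simpa using LipschitzWith.prod_fst.prodMk ((htr (B t)).comp LipschitzWith.prod_snd)
      simpa [Function.comp_def] using (lipschitzWith_flowField hK ht).comp h1⟩)
    (fun T => by
      obtain ⟨b, hb⟩ := isCompact_Icc.bddAbove_image (hBc.continuousOn (s := Set.Icc (-T) T))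
      refine ⟨Real.toNNReal (weightBound m T * max b κ), fun t ht x => ?_⟩
      have hbt : B t ≤ b := hb ⟨t, ht, rfl⟩
      have hw : 0 ≤ weightBound m T := (Real.exp_pos _).le
      have hmax : 0 ≤ max b κ := hκ.trans (le_max_right _ _)
      rw [Real.coe_toNNReal _ (mul_nonneg hw hmax), Prod.norm_def]
      refine max_le ?_ ?_
      · simp only [flowField, norm_neg, norm_div, Real.norm_eq_abs, abs_of_pos (expWeight_pos m t)]
        rw [div_eq_inv_mul]
        exact mul_le_mul (inv_expWeight_le_weightBound (abs_le.2 ht))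
          (((htrb _ (hB0 t) _).trans hbt).trans (le_max_left _ _)) (abs_nonneg _) hw
      · simp only [flowField, norm_mul, Real.norm_eq_abs, abs_of_pos (expWeight_pos m t),
          abs_of_nonneg (reaction_nonneg hκ hp _)]
        exact mul_le_mul (expWeight_le_weightBound (abs_le.2 ht))
          ((reaction_le hκ _).trans (le_max_right _ _)) (reaction_nonneg hκ hp _) hw)
    t₀ (u₀, M₀)
  have hf1 : ∀ t, HasDerivAt (fun t => (f t).1) _ t := fun t => (hf t).fst
  have hf2 : ∀ t, HasDerivAt (fun t => (f t).2) _ t := fun t => (hf t).snd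
  have hbound : ∀ t, |(f t).2| ≤ B t := by
    intro t
    have h := (convex_uIcc t₀ t).norm_image_sub_le_of_norm_hasDerivWithin_le
      (f := fun t => (f t).2) (C := weightBound m (|t| + |t₀|) * κ)
      (fun s _ => (hf2 s).hasDerivWithinAt) (fun s hs => ?_) Set.left_mem_uIcc Set.right_mem_uIcc
    · rw [Real.norm_eq_abs, Real.norm_eq_abs, hf0] at h
      have := abs_sub_abs_le_abs_sub (f t).2 M₀
      simp only [hBdef]
      linarith
    · simp only [flowField, norm_mul, Real.norm_eq_abs, abs_of_pos (expWeight_pos m s),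
          abs_of_nonneg (reaction_nonneg hκ hp _)]
      have hs' : |s| ≤ |t| + |t₀| := by
        rcases Set.mem_uIcc.1 hs with h | h <;> rw [abs_le] <;>
          constructor <;> linarith [neg_abs_le t, neg_abs_le t₀, le_abs_self t, le_abs_self t₀,
            abs_nonneg t, abs_nonneg t₀]
      exact mul_le_mul (expWeight_le_weightBound hs') (reaction_le hκ _)
        (reaction_nonneg hκ hp _) (Real.exp_pos _).le
  refine ⟨fun t => (f t).1, fun t => (f t).2, by simp [hf0], by simp [hf0], fun t => ?_, hf2⟩
  have := hf1 t
  have hb := abs_le.1 (hbound t)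
  simp only [flowField, min_eq_left hb.2, max_eq_right hb.1] at this
  exact this

/-- Continuous dependence on the data, quantitatively on bounded intervals. -/
theorem IsFlow.exists_dist_le {m κ p : ℝ} (hp : 1 ≤ p) (T : ℝ) : ∃ C : ℝ, 0 < C ∧
    ∀ φ M ψ N : ℝ → ℝ, IsFlow m κ p φ M → IsFlow m κ p ψ N →
    ∀ s ∈ Set.Icc (-T) T, ∀ t ∈ Set.Icc (-T) T,
      dist (φ t, M t) (ψ t, N t) ≤ dist (φ s, M s) (ψ s, N s) * C := by
  obtain ⟨K, hK⟩ := exists_lipschitzWith_reaction (κ := κ) hp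
  refine ⟨Real.exp ((Real.toNNReal (weightBound m T) * max 1 K : NNReal) * (2 * T)),
    Real.exp_pos _, fun φ M ψ N h h' s hs t ht => ?_⟩
  refine (dist_le_of_trajectories (V := flowField m κ p)
    (fun t ht => lipschitzWith_flowField hK ht)
    h.hasDerivAt_prodMk h'.hasDerivAt_prodMk hs ht).trans ?_
  gcongr
  rw [abs_le]
  constructor <;> linarith [hs.1, hs.2, ht.1, ht.2]

theorem IsFlow.unique {m κ p : ℝ} (hp : 1 ≤ p) {φ M ψ N : ℝ → ℝ} (h : IsFlow m κ p φ M)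
    (h' : IsFlow m κ p ψ N) {s : ℝ} (h1 : φ s = ψ s) (h2 : M s = N s) (t : ℝ) :
    φ t = ψ t ∧ M t = N t := by
  obtain ⟨C, -, hC⟩ := IsFlow.exists_dist_le (m := m) (κ := κ) hp (|s| + |t|)
  have := hC φ M ψ N h h' s (abs_le.1 (by linarith [abs_nonneg t])) t
    (abs_le.1 (by linarith [abs_nonneg s]))
  rw [h1, h2, dist_self, zero_mul] at this
  exact Prod.mk.inj (dist_le_zero.1 this)

theorem IsFlow.tendsto {m κ p : ℝ} (hp : 1 ≤ p) {φ M : ℝ → ℝ} (h : IsFlow m κ p φ M)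
    {ι : Type*} {l : Filter ι} {ψ N : ι → ℝ → ℝ} (h' : ∀ i, IsFlow m κ p (ψ i) (N i)) {s : ℝ}
    (h1 : Tendsto (fun i => ψ i s) l (𝓝 (φ s))) (h2 : Tendsto (fun i => N i s) l (𝓝 (M s)))
    (t : ℝ) : Tendsto (fun i => ψ i t) l (𝓝 (φ t)) := by
  obtain ⟨C, -, hC⟩ := IsFlow.exists_dist_le (m := m) (κ := κ) hp (|s| + |t|)
  have h3 : Tendsto (fun i => dist (ψ i s, N i s) (φ s, M s) * C) l (𝓝 0) := by
    simpa using (tendsto_iff_dist_tendsto_zero.1 (h1.prodMk_nhds h2)).mul_const C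
  refine tendsto_iff_dist_tendsto_zero.2 (squeeze_zero (fun _ => dist_nonneg) (fun i => ?_) h3)
  exact (le_max_left _ _).trans (hC _ _ _ _ (h' i) h s
    (abs_le.1 (by linarith [abs_nonneg t])) t (abs_le.1 (by linarith [abs_nonneg s])))

/-! ### Comparison and barriers -/

/-- One-dimensional maximum principle: if `g > 0` and `g v'` is nondecreasing, then `v` has no
interior maximum above its boundary values. -/
theorem le_max_of_monotoneOn_mul_deriv {g v v' : ℝ → ℝ} {a b : ℝ}
    (hv : ∀ x ∈ Set.Icc a b, HasDerivAt v (v' x) x) (hg : ∀ x ∈ Set.Icc a b, 0 < g x)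
    (hmono : MonotoneOn (fun x => g x * v' x) (Set.Icc a b)) {x : ℝ} (hx : x ∈ Set.Icc a b) :
    v x ≤ max (v a) (v b) := by
  by_contra! hlt
  obtain ⟨h1, h2⟩ := max_lt_iff.1 hlt
  have hax : a < x := lt_of_le_of_ne hx.1 (by rintro rfl; exact lt_irrefl _ h1)
  have hxb : x < b := lt_of_le_of_ne hx.2 (by rintro rfl; exact lt_irrefl _ h2)
  have hsub1 : Set.Icc a x ⊆ Set.Icc a b := Set.Icc_subset_Icc_right hx.2
  have hsub2 : Set.Icc x b ⊆ Set.Icc a b := Set.Icc_subset_Icc_left hx.1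
  obtain ⟨y, hy, hy'⟩ := exists_hasDerivAt_eq_slope v v' hax
    (fun z hz => (hv z (hsub1 hz)).continuousAt.continuousWithinAt)
    (fun z hz => hv z (hsub1 (Set.Ioo_subset_Icc_self hz)))
  obtain ⟨z, hz, hz'⟩ := exists_hasDerivAt_eq_slope v v' hxb
    (fun z hz => (hv z (hsub2 hz)).continuousAt.continuousWithinAt)
    (fun z hz => hv z (hsub2 (Set.Ioo_subset_Icc_self hz)))
  have hyI := hsub1 (Set.Ioo_subset_Icc_self hy)
  have hzI := hsub2 (Set.Ioo_subset_Icc_self hz)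
  have hpos : 0 < v' y := by rw [hy']; exact div_pos (by linarith) (by linarith)
  have hneg : v' z < 0 := by
    rw [hz']; exact div_neg_of_neg_of_pos (by linarith) (by linarith)
  have := hmono hyI hzI (hy.2.trans hz.1).le
  have p1 := mul_pos (hg y hyI) hpos
  have p2 := mul_neg_of_pos_of_neg (hg z hzI) hneg
  simp only at this
  linarith

theorem monotoneOn_Icc_of_hasDerivAt {f f' : ℝ → ℝ} {a b : ℝ}
    (hf : ∀ x ∈ Set.Icc a b, HasDerivAt f (f' x) x) (h : ∀ x ∈ Set.Icc a b, 0 ≤ f' x) :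
    MonotoneOn f (Set.Icc a b) :=
  monotoneOn_of_hasDerivWithinAt_nonneg (f' := f') (convex_Icc a b)
    (fun x hx => (hf x hx).continuousAt.continuousWithinAt)
    (fun x hx => (hf x (interior_subset hx)).hasDerivWithinAt)
    (fun x hx => h x (interior_subset hx))

theorem antitoneOn_Icc_of_hasDerivAt {f f' : ℝ → ℝ} {a b : ℝ}
    (hf : ∀ x ∈ Set.Icc a b, HasDerivAt f (f' x) x) (h : ∀ x ∈ Set.Icc a b, f' x ≤ 0) :
    AntitoneOn f (Set.Icc a b) :=
  antitoneOn_of_hasDerivWithinAt_nonpos (f' := f') (convex_Icc a b)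
    (fun x hx => (hf x hx).continuousAt.continuousWithinAt)
    (fun x hx => (hf x (interior_subset hx)).hasDerivWithinAt)
    (fun x hx => h x (interior_subset hx))

theorem IsFlow.monotone_right {m κ p : ℝ} (hκ : 0 ≤ κ) (hp : 1 ≤ p) {φ M : ℝ → ℝ}
    (h : IsFlow m κ p φ M) : Monotone M :=
  monotone_of_hasDerivAt_nonneg h.right
    (fun ζ => mul_nonneg (expWeight_pos m ζ).le (reaction_nonneg hκ hp _))

theorem isFlow_one (m κ p : ℝ) : IsFlow m κ p (fun _ => 1) (fun _ => 0) where
  left ζ := by simpa using hasDerivAt_const ζ (1 : ℝ)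
  right ζ := by simpa [reaction, clip] using hasDerivAt_const ζ (0 : ℝ)

theorem isFlow_zero (m κ : ℝ) {p : ℝ} (hp : 0 < p) :
    IsFlow m κ p (fun _ => 0) (fun _ => 0) where
  left ζ := by simpa using hasDerivAt_const ζ (0 : ℝ)
  right ζ := by simpa [reaction, clip, Real.zero_rpow hp.ne'] using hasDerivAt_const ζ (0 : ℝ)

/-- A lower bound of the flux at the left endpoint forces a linear decrease of the profile. -/
theorem IsFlow.apply_le {m κ p : ℝ} (hκ : 0 ≤ κ) (hp : 1 ≤ p) {φ M : ℝ → ℝ}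
    (h : IsFlow m κ p φ M) {a b T : ℝ} (hab : a ≤ b) (ha : |a| ≤ T) (hb : |b| ≤ T)
    (hM : 0 ≤ M a) : φ b ≤ φ a - M a / weightBound m T * (b - a) := by
  have hd : ∀ x ∈ Set.Icc a b, HasDerivAt (fun x => φ x + M a / weightBound m T * x)
      (-(M x / expWeight m x) + M a / weightBound m T) x := fun x _ => by
    exact ((h.left x).add ((hasDerivAt_id x).const_mul (M a / weightBound m T))).congr_deriv
      (by simp)
  have := antitoneOn_Icc_of_hasDerivAt hd (fun x hx => by
    have hx' : |x| ≤ T := by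
      rw [abs_le] at *; constructor <;> linarith [hx.1, hx.2]
    have h1 : M a ≤ M x := h.monotone_right hκ hp hx.1
    have : M a / weightBound m T ≤ M x / expWeight m x :=
      div_le_div₀ (hM.trans h1) h1 (expWeight_pos m x) (expWeight_le_weightBound hx')
    linarith) (Set.left_mem_Icc.2 hab) (Set.right_mem_Icc.2 hab) hab
  simp only at this
  linarith

theorem IsFlow.antitoneOn {m κ p : ℝ} (hκ : 0 ≤ κ) (hp : 1 ≤ p) {φ M : ℝ → ℝ}
    (h : IsFlow m κ p φ M) {a b : ℝ} (hM : 0 ≤ M a) : AntitoneOn φ (Set.Icc a b) :=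
  antitoneOn_Icc_of_hasDerivAt (fun x _ => h.left x) (fun x hx => by
    have h1 : M a ≤ M x := h.monotone_right hκ hp hx.1
    have := div_nonneg (hM.trans h1) (expWeight_pos m x).le
    linarith)

/-- Shooting: the boundary value problem on `[-n, n]` with boundary values `1` and `0` is
solvable. -/
theorem exists_isFlow_boundary {m κ p : ℝ} (hκ : 0 ≤ κ) (hp : 1 ≤ p) {n : ℝ} (hn : 0 < n) :
    ∃ φ M : ℝ → ℝ, IsFlow m κ p φ M ∧ φ (-n) = 1 ∧ φ n = 0 ∧ 0 ≤ M (-n) ∧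
      ∀ ζ ∈ Set.Icc (-n) n, 0 ≤ φ ζ ∧ φ ζ ≤ 1 := by
  choose φ M hφ hM hfl using fun a => exists_isFlow (m := m) hκ hp (-n) 1 a
  have hnn : -n ∈ Set.Icc (-n) n := ⟨le_rfl, by linarith⟩
  have hnn' : n ∈ Set.Icc (-n) n := ⟨by linarith, le_rfl⟩
  obtain ⟨C, hC0, hC⟩ := IsFlow.exists_dist_le (m := m) (κ := κ) hp n
  have hcont : Continuous fun a => φ a n := by
    refine (LipschitzWith.of_dist_le_mul (K := Real.toNNReal C) fun a b => ?_).continuous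
    refine (le_max_left _ _).trans
      ((hC _ _ _ _ (hfl a) (hfl b) (-n) hnn n hnn').trans ?_)
    rw [hφ, hφ, hM, hM, Prod.dist_eq, dist_self, max_eq_right dist_nonneg,
      Real.coe_toNNReal _ hC0.le, mul_comm]
  have h0 : φ 0 n = 1 :=
    ((hfl 0).unique hp (isFlow_one m κ p) (hφ 0) (hM 0) n).1
  have hR : 0 < weightBound m n := Real.exp_pos _
  -- with zero flux the solution is constant; with flux `A` it is at most `0` at `n`
  set A := weightBound m n / (2 * n) with hA
  have hA0 : 0 ≤ A := by positivity
  have hA1 : φ A n ≤ 0 := by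
    have := (hfl A).apply_le hκ hp (a := -n) (b := n) (T := n) (by linarith)
      (by rw [abs_neg, abs_of_pos hn]) (by rw [abs_of_pos hn]) (by rwa [hM])
    rw [hφ, hM] at this
    have h2 : A / weightBound m n * (n - -n) = 1 := by rw [hA]; field_simp; ring
    linarith
  obtain ⟨a, ha, ha0⟩ := intermediate_value_Icc' hA0 hcont.continuousOn
    (show (0 : ℝ) ∈ Set.Icc (φ A n) (φ 0 n) from ⟨hA1, by rw [h0]; exact zero_le_one⟩)
  have hMa : 0 ≤ M a (-n) := by rw [hM]; exact ha.1
  refine ⟨φ a, M a, hfl a, hφ a, ha0, hMa, fun ζ hζ => ?_⟩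
  have hanti := (hfl a).antitoneOn hκ hp (a := -n) (b := n) hMa
  exact ⟨ha0 ▸ hanti hζ hnn' hζ.2, hφ a ▸ hanti hnn hζ hζ.1⟩

/-- Lower barrier: up to a constant, `1 - φ` is dominated by `e^{mζ/2}`, which satisfies
`(ρ v')' ≤ 0` as long as `e^{2ζ} ≤ m`. -/
theorem IsFlow.lower_barrier {m κ p : ℝ} (hκ : 0 ≤ κ) (hp : 1 ≤ p) (hm : 0 < m) {φ M : ℝ → ℝ}
    (h : IsFlow m κ p φ M) {n : ℝ} (hn : Real.log m / 2 ≤ n) (h1 : φ (-n) = 1)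
    (hpos : ∀ ζ ∈ Set.Icc (-n) n, 0 ≤ φ ζ) {ζ : ℝ} (hζ : ζ ∈ Set.Icc (-n) n) :
    1 - Real.exp (m / 2 * (ζ - Real.log m / 2)) ≤ φ ζ := by
  set z := Real.log m / 2 with hz
  rcases le_total z ζ with hzζ | hzζ
  · have : 1 ≤ Real.exp (m / 2 * (ζ - z)) :=
      Real.one_le_exp (mul_nonneg (by linarith) (by linarith))
    linarith [hpos ζ hζ]
  set e : ℝ → ℝ := fun ζ => Real.exp (m / 2 * (ζ - z)) with he
  have hed : ∀ x, HasDerivAt e (e x * (m / 2)) x := fun x => by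
    simpa using (((hasDerivAt_id x).sub_const z).const_mul (m / 2)).exp
  have hv : ∀ x ∈ Set.Icc (-n) z, HasDerivAt (fun x => 1 - φ x - e x)
      (M x / expWeight m x - e x * (m / 2)) x := fun x _ => by
    exact (((h.left x).const_sub 1).sub (hed x)).congr_deriv (by simp)
  have hmono : MonotoneOn (fun x => expWeight m x * (M x / expWeight m x - e x * (m / 2)))
      (Set.Icc (-n) z) := by
    have heq : (fun x => expWeight m x * (M x / expWeight m x - e x * (m / 2)))
        = fun x => M x - m / 2 * (expWeight m x * e x) := by
      ext x
      have := (expWeight_pos m x).ne'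
      field_simp
    rw [heq]
    refine monotoneOn_Icc_of_hasDerivAt (fun x _ => (h.right x).sub
      (((hasDerivAt_expWeight m x).mul (hed x)).const_mul (m / 2))) (fun x hx => ?_)
    have h1 : Real.exp (2 * x) ≤ m := by
      rw [← Real.exp_log hm]
      gcongr
      have := hx.2
      rw [hz] at this
      linarith
    have h2 := mul_nonneg (expWeight_pos m x).le (reaction_nonneg hκ hp (φ x))
    have h3 : 0 ≤ expWeight m x * e x := mul_nonneg (expWeight_pos m x).le (Real.exp_pos _).le
    have h4 : 0 ≤ m / 2 * (expWeight m x * e x) * (m / 2 - Real.exp (2 * x) / 2) :=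
      mul_nonneg (mul_nonneg (by linarith) h3) (by linarith)
    linarith
  have := le_max_of_monotoneOn_mul_deriv hv (fun x _ => expWeight_pos m x) hmono
    (x := ζ) ⟨hζ.1, hzζ⟩
  have hzn : z ∈ Set.Icc (-n) n := ⟨hζ.1.trans hzζ, hn⟩
  have hmax : max (1 - φ (-n) - e (-n)) (1 - φ z - e z) ≤ 0 := by
    refine max_le ?_ ?_
    · rw [h1]
      have : 0 ≤ e (-n) := (Real.exp_pos _).le
      linarith
    · have h2 : e z = 1 := by simp [he]
      linarith [hpos z hzn]
  simp only [he] at this hmax ⊢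
  linarith

/-- Upper barrier: `e^{-ζ} / ρ` is a supersolution of the linearization at `0` for large `ζ`. -/
theorem IsFlow.upper_barrier {m κ p : ℝ} (hκ : 0 ≤ κ) {φ M : ℝ → ℝ}
    (h : IsFlow m κ p φ M) {z n : ℝ} (hz : κ ≤ m - 1 + Real.exp (2 * z) / 2)
    (hn : φ n = 0) (hpos : ∀ ζ ∈ Set.Icc z n, 0 ≤ φ ζ ∧ φ ζ ≤ 1) {ζ : ℝ}
    (hζ : ζ ∈ Set.Icc z n) :
    φ ζ * expWeight m ζ * Real.exp ζ ≤ expWeight m z * Real.exp z := by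
  have hv : ∀ x ∈ Set.Icc z n, HasDerivAt (fun x => φ x * expWeight m x * Real.exp x)
      (Real.exp x * (-M x + expWeight m x * φ x * (Real.exp (2 * x) / 2 - (m - 1)))) x := by
    intro x _
    refine (((h.left x).mul (hasDerivAt_expWeight m x)).mul (Real.hasDerivAt_exp x)).congr_deriv ?_
    have := (expWeight_pos m x).ne'
    simp only [Pi.mul_apply]
    field_simp
    ring
  have hmono : MonotoneOn (fun x => (Real.exp (-(2 * x)) / expWeight m x) *
      (Real.exp x * (-M x + expWeight m x * φ x * (Real.exp (2 * x) / 2 - (m - 1)))))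
      (Set.Icc z n) := by
    have heq : (fun x => (Real.exp (-(2 * x)) / expWeight m x) *
        (Real.exp x * (-M x + expWeight m x * φ x * (Real.exp (2 * x) / 2 - (m - 1)))))
        = fun x => Real.exp (-x) *
          (-(M x / expWeight m x) + φ x * (Real.exp (2 * x) / 2 - (m - 1))) := by
      ext x
      have h1 := (expWeight_pos m x).ne'
      have h2 : Real.exp (-(2 * x)) * Real.exp x = Real.exp (-x) := by
        rw [← Real.exp_add]; ring_nf
      rw [← h2]
      field_simp
    rw [heq]
    refine monotoneOn_Icc_of_hasDerivAt
      (f' := fun x => Real.exp (-x) * (φ x * (m - 1 + Real.exp (2 * x) / 2)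
        - reaction κ p (φ x))) (fun x _ => ?_) (fun x hx => ?_)
    · have h1 : HasDerivAt (fun x : ℝ => Real.exp (-x)) (-Real.exp (-x)) x := by
        simpa using (hasDerivAt_neg x).exp
      have h2 : HasDerivAt (fun x : ℝ => Real.exp (2 * x) / 2 - (m - 1)) (Real.exp (2 * x)) x := by
        have h2 : HasDerivAt (fun ζ : ℝ => 2 * ζ) 2 x := by
          simpa using (hasDerivAt_id x).const_mul 2
        exact ((h2.exp.div_const 2).sub_const (m - 1)).congr_deriv (by ring)
      have h3 := (h.right x).div (hasDerivAt_expWeight m x) (expWeight_pos m x).ne'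
      refine (h1.mul (h3.neg.add ((h.left x).mul h2))).congr_deriv ?_
      have := (expWeight_pos m x).ne'
      simp only [Pi.add_apply, Pi.mul_apply, Pi.neg_apply, Pi.div_apply]
      field_simp
      ring
    · refine mul_nonneg (Real.exp_pos _).le ?_
      obtain ⟨h0, h1⟩ := hpos x hx
      rw [reaction_of_mem h0 h1]
      have h2 : Real.exp (2 * z) ≤ Real.exp (2 * x) := by gcongr; exact hx.1
      have h3 := mul_nonneg hκ (Real.rpow_nonneg h0 p)
      nlinarith
  have := le_max_of_monotoneOn_mul_deriv hv
    (fun x _ => div_pos (Real.exp_pos _) (expWeight_pos m x)) hmono hζ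
  have hzn : z ∈ Set.Icc z n := ⟨le_rfl, hζ.1.trans hζ.2⟩
  refine this.trans (max_le ?_ ?_)
  · rw [mul_assoc]
    exact mul_le_of_le_one_left (mul_pos (expWeight_pos m z) (Real.exp_pos z)).le (hpos z hzn).2
  · rw [hn, zero_mul, zero_mul]
    exact (mul_pos (expWeight_pos m z) (Real.exp_pos z)).le

theorem tendsto_exp_sub_mul_atTop (c : ℝ) :
    Tendsto (fun ζ : ℝ => Real.exp (2 * ζ) / 4 - c * ζ) atTop atTop := by
  have h1 : Tendsto (fun ζ : ℝ => ζ * (ζ / 2 - c)) atTop atTop :=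
    tendsto_id.atTop_mul_atTop₀ (tendsto_atTop_add_const_right _ (-c)
      (tendsto_id.atTop_div_const two_pos))
  refine tendsto_atTop_mono' _ ?_ h1
  filter_upwards [eventually_ge_atTop 0] with ζ hζ
  have := Real.quadratic_le_exp_of_nonneg (x := 2 * ζ) (by linarith)
  nlinarith

/-- The weight grows faster than every exponential at `+∞`. -/
theorem tendsto_exp_div_expWeight_atTop (m k : ℝ) :
    Tendsto (fun ζ => Real.exp (k * ζ) / expWeight m ζ) atTop (𝓝 0) := by
  have : (fun ζ => Real.exp (k * ζ) / expWeight m ζ)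
      = fun ζ => Real.exp (-(Real.exp (2 * ζ) / 4 - (m + k) * ζ)) := by
    ext ζ
    rw [expWeight, ← Real.exp_sub]; congr 1; ring
  rw [this]
  exact Real.tendsto_exp_neg_atTop_nhds_zero.comp (tendsto_exp_sub_mul_atTop (m + k))

/-- Solutions of the first order system with values in `[0, 1]` that come arbitrarily close to `1`
near `-∞` and drop below every multiple of `e^{-2ζ}` near `+∞`. These two conditions are all that is
used of the membership `φ - η ∈ H¹(ℝ, dμ)`. -/
structure IsProfile (m κ p : ℝ) (φ M : ℝ → ℝ) : Prop extends IsFlow m κ p φ M where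
  mem : ∀ ζ, 0 ≤ φ ζ ∧ φ ζ ≤ 1
  near_one : ∀ ε > 0, ∀ z, ∃ ζ ≤ z, 1 - ε < φ ζ
  near_zero : ∀ ε > 0, ∀ z, ∃ ζ ≥ z, φ ζ < ε * Real.exp (-(2 * ζ))

/-- Existence: the solutions on `[-n, n]` converge along a subsequence, since their data at `0` are
bounded, and the barriers survive in the limit. -/
theorem exists_isProfile {m κ p : ℝ} (hκ : 0 ≤ κ) (hp : 1 ≤ p) (hm : 0 < m) :
    ∃ φ M : ℝ → ℝ, IsProfile m κ p φ M := by
  have hn1 : ∀ k : ℕ, (0 : ℝ) < k + 1 := fun k => by positivity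
  choose ψ N hfl hl hr hN hmem using fun k : ℕ =>
    exists_isFlow_boundary (m := m) hκ hp (hn1 k)
  set R := weightBound m 1
  have hR : 0 < R := Real.exp_pos _
  have hdata : ∀ k, (ψ k 0, N k 0) ∈ Set.Icc (0 : ℝ) 1 ×ˢ Set.Icc 0 R := by
    intro k
    have hk : (0 : ℝ) ≤ k := by positivity
    have h0 := hmem k 0 ⟨by linarith, by linarith⟩
    have h1 := hmem k 1 ⟨by linarith, by linarith⟩
    have hN0 : 0 ≤ N k 0 := (hN k).trans ((hfl k).monotone_right hκ hp (by linarith))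
    refine ⟨h0, hN0, ?_⟩
    have := (hfl k).apply_le hκ hp (a := 0) (b := 1) (T := 1) zero_le_one (by simp) (by simp) hN0
    have h2 : N k 0 / R ≤ 1 := by
      simp only [sub_zero, mul_one] at this
      linarith [h0.2, h1.1]
    rwa [div_le_one hR] at h2
  obtain ⟨⟨u, v⟩, -, s, hs, hlim⟩ :=
    (isCompact_Icc.prod isCompact_Icc).tendsto_subseq hdata
  obtain ⟨φ, M, hφ0, hM0, h⟩ := exists_isFlow (m := m) hκ hp 0 u v
  have hconv : ∀ ζ, Tendsto (fun k => ψ (s k) ζ) atTop (𝓝 (φ ζ)) := by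
    refine h.tendsto hp (fun k => hfl (s k)) (s := 0) ?_ ?_
    · rw [hφ0]; exact (continuous_fst.tendsto _).comp hlim
    · rw [hM0]; exact (continuous_snd.tendsto _).comp hlim
  have hbig : ∀ c : ℝ, ∀ᶠ k in atTop, c ≤ (s k : ℝ) + 1 := fun c => by
    have h1 : Tendsto (fun k => (s k : ℝ) + 1) atTop atTop :=
      tendsto_atTop_add_const_right _ _ (tendsto_natCast_atTop_atTop.comp hs.tendsto_atTop)
    exact h1.eventually_ge_atTop c
  have hin : ∀ ζ : ℝ, ∀ᶠ k in atTop, ζ ∈ Set.Icc (-((s k : ℝ) + 1)) ((s k : ℝ) + 1) := fun ζ => by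
    filter_upwards [hbig |ζ|] with k hk using abs_le.1 hk
  have hlow : ∀ ζ, 1 - Real.exp (m / 2 * (ζ - Real.log m / 2)) ≤ φ ζ := fun ζ => by
    refine ge_of_tendsto (hconv ζ) ?_
    filter_upwards [hin ζ, hbig (Real.log m / 2)] with k hk hk'
    exact (hfl (s k)).lower_barrier hκ hp hm hk' (hl _) (fun x hx => (hmem _ x hx).1) hk
  obtain ⟨z, hz⟩ : ∃ z : ℝ, κ ≤ m - 1 + Real.exp (2 * z) / 2 := by
    have h1 : Tendsto (fun z : ℝ => m - 1 + Real.exp (2 * z) / 2) atTop atTop :=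
      tendsto_atTop_add_const_left _ _ ((Real.tendsto_exp_atTop.comp
        (tendsto_id.const_mul_atTop two_pos)).atTop_div_const two_pos)
    exact (h1.eventually_ge_atTop κ).exists
  have hup : ∀ ζ, z ≤ ζ → φ ζ * expWeight m ζ * Real.exp ζ ≤ expWeight m z * Real.exp z := by
    intro ζ hζ
    refine le_of_tendsto (((hconv ζ).mul_const _).mul_const _) ?_
    filter_upwards [hin ζ, hin z] with k hk hk'
    exact (hfl (s k)).upper_barrier hκ hz (hr _)
      (fun x hx => hmem _ x ⟨hk'.1.trans hx.1, hx.2⟩) ⟨hζ, hk.2⟩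
  refine ⟨φ, M, h, fun ζ => ⟨?_, ?_⟩, fun ε hε y => ?_, fun ε hε y => ?_⟩
  · refine ge_of_tendsto (hconv ζ) ?_
    filter_upwards [hin ζ] with k hk using (hmem _ ζ hk).1
  · refine le_of_tendsto (hconv ζ) ?_
    filter_upwards [hin ζ] with k hk using (hmem _ ζ hk).2
  · have h1 : Tendsto (fun ζ : ℝ => Real.exp (m / 2 * (ζ - Real.log m / 2))) atBot (𝓝 0) :=
      Real.tendsto_exp_atBot.comp ((tendsto_atBot_add_const_right _ _ tendsto_id).const_mul_atBot
        (by linarith))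
    obtain ⟨ζ, hζ, hζ'⟩ := ((h1.eventually_lt_const hε).and (eventually_le_atBot y)).exists
    exact ⟨ζ, hζ', by linarith [hlow ζ]⟩
  · have h1 := (tendsto_exp_div_expWeight_atTop m 1).const_mul (expWeight m z * Real.exp z)
    rw [mul_zero] at h1
    obtain ⟨ζ, hζ, hζ', hζ''⟩ := ((h1.eventually_lt_const hε).and
      ((eventually_ge_atTop y).and (eventually_ge_atTop z))).exists
    refine ⟨ζ, hζ', ?_⟩
    have h2 := hup ζ hζ''
    have h3 := expWeight_pos m ζ
    have h4 := Real.exp_pos ζ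
    have h5 : Real.exp (-(2 * ζ)) * Real.exp ζ * Real.exp ζ = 1 := by
      rw [← Real.exp_add, ← Real.exp_add]; simp; ring
    rw [one_mul, mul_div_assoc', div_lt_iff₀ h3] at hζ
    have h6 : φ ζ * expWeight m ζ * Real.exp ζ * Real.exp ζ < ε * expWeight m ζ :=
      (mul_le_mul_of_nonneg_right h2 h4.le).trans_lt hζ
    have h7 : φ ζ * (Real.exp ζ * Real.exp ζ) < ε := by
      by_contra! hc
      nlinarith
    have h8 := mul_lt_mul_of_pos_right h7 (Real.exp_pos (-(2 * ζ)))
    calc φ ζ = φ ζ * (Real.exp ζ * Real.exp ζ) * Real.exp (-(2 * ζ)) := by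
          linear_combination -φ ζ * h5
      _ < _ := h8

/-! ### Qualitative properties of profiles -/

section Profile

variable {m κ p : ℝ} {φ M : ℝ → ℝ}

/-- If the flux were negative somewhere, `φ` would be increasing near `-∞` and stay away from its
supremum `1` there. -/
theorem IsProfile.flux_nonneg (h : IsProfile m κ p φ M) (hκ : 0 ≤ κ) (hp : 1 ≤ p) (z : ℝ) :
    0 ≤ M z := by
  by_contra! hz
  have hd : ∀ ζ ≤ z, 0 < -(M ζ / expWeight m ζ) := fun ζ hζ => by
    have h1 : M ζ ≤ M z := h.toIsFlow.monotone_right hκ hp hζ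
    have := div_neg_of_neg_of_pos (h1.trans_lt hz) (expWeight_pos m ζ)
    linarith
  have hmono : StrictMonoOn φ (Set.Iic z) :=
    strictMonoOn_of_hasDerivWithinAt_pos (convex_Iic z)
      (fun ζ _ => (h.left ζ).continuousAt.continuousWithinAt)
      (fun ζ _ => (h.left ζ).hasDerivWithinAt)
      (fun ζ hζ => hd ζ (interior_subset (s := Set.Iic z) hζ))
  have h1 : φ (z - 1) < φ z :=
    hmono (Set.mem_Iic.2 (by linarith)) (Set.mem_Iic.2 le_rfl) (by linarith)
  obtain ⟨ζ, hζ, hζ'⟩ := h.near_one (1 - φ (z - 1)) (by linarith [(h.mem z).2]) (z - 1)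
  have := hmono.monotoneOn (Set.mem_Iic.2 (by linarith)) (Set.mem_Iic.2 (by linarith)) hζ
  linarith

theorem IsProfile.antitone (h : IsProfile m κ p φ M) (hκ : 0 ≤ κ) (hp : 1 ≤ p) : Antitone φ :=
  antitone_of_hasDerivAt_nonpos h.left fun ζ => neg_nonpos.2
    (div_nonneg (h.flux_nonneg hκ hp ζ) (expWeight_pos m ζ).le)

theorem eq_zero_of_neg_div_expWeight {a z : ℝ} (hz : -(a / expWeight m z) = 0) : a = 0 := by
  rcases div_eq_zero_iff.1 (neg_eq_zero.1 hz) with h1 | h1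
  · exact h1
  · exact absurd h1 (expWeight_pos m z).ne'

/-- A zero of the profile would be a minimum, hence a zero of the flux as well. -/
theorem IsProfile.pos (h : IsProfile m κ p φ M) (hp : 1 ≤ p) (z : ℝ) : 0 < φ z := by
  refine lt_of_le_of_ne (h.mem z).1 fun hz => ?_
  have hmin : IsLocalMin φ z := Filter.Eventually.of_forall fun ζ => hz ▸ (h.mem ζ).1
  have hM := eq_zero_of_neg_div_expWeight (hmin.hasDerivAt_eq_zero (h.left z))
  have h0 := h.toIsFlow.unique hp (isFlow_zero m κ (by linarith)) hz.symm hM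
  obtain ⟨ζ, -, hζ⟩ := h.near_one (1 / 2) (by norm_num) 0
  rw [(h0 ζ).1] at hζ
  norm_num at hζ

/-- A point where the profile equals `1` would be a maximum, hence a zero of the flux as well. -/
theorem IsProfile.lt_one (h : IsProfile m κ p φ M) (hp : 1 ≤ p) (z : ℝ) : φ z < 1 := by
  refine lt_of_le_of_ne (h.mem z).2 fun hz => ?_
  have hmax : IsLocalMax φ z := Filter.Eventually.of_forall fun ζ => hz ▸ (h.mem ζ).2
  have hM := eq_zero_of_neg_div_expWeight (hmax.hasDerivAt_eq_zero (h.left z))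
  have h0 := h.toIsFlow.unique hp (isFlow_one m κ p) hz hM
  obtain ⟨ζ, hζ0, hζ⟩ := h.near_zero 1 one_pos 0
  rw [(h0 ζ).1, one_mul] at hζ
  have : Real.exp (-(2 * ζ)) ≤ 1 := Real.exp_le_one_iff.2 (by linarith)
  linarith

theorem IsProfile.reaction_eq (h : IsProfile m κ p φ M) (ζ : ℝ) :
    reaction κ p (φ ζ) = κ * (φ ζ - φ ζ ^ p) :=
  reaction_of_mem (h.mem ζ).1 (h.mem ζ).2

theorem IsProfile.reaction_pos (h : IsProfile m κ p φ M) (hκ : 0 < κ) (hp : 1 < p) (ζ : ℝ) :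
    0 < reaction κ p (φ ζ) := by
  rw [h.reaction_eq]
  have := Real.rpow_lt_rpow_of_exponent_gt (h.pos hp.le ζ) (h.lt_one hp.le ζ) hp
  rw [Real.rpow_one] at this
  exact mul_pos hκ (by linarith)

theorem IsProfile.reaction_le_mul (h : IsProfile m κ p φ M) (hκ : 0 ≤ κ) (ζ : ℝ) :
    reaction κ p (φ ζ) ≤ κ * φ ζ := by
  rw [h.reaction_eq]
  have := Real.rpow_nonneg (h.mem ζ).1 p
  gcongr
  linarith

theorem IsProfile.flux_strictMono (h : IsProfile m κ p φ M) (hκ : 0 < κ) (hp : 1 < p) :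
    StrictMono M :=
  strictMono_of_hasDerivAt_pos h.right
    fun ζ => mul_pos (expWeight_pos m ζ) (h.reaction_pos hκ hp ζ)

theorem IsProfile.flux_pos (h : IsProfile m κ p φ M) (hκ : 0 < κ) (hp : 1 < p) (ζ : ℝ) :
    0 < M ζ :=
  (h.flux_nonneg hκ.le hp.le (ζ - 1)).trans_lt (h.flux_strictMono hκ hp (by linarith))

theorem IsProfile.strictAnti (h : IsProfile m κ p φ M) (hκ : 0 < κ) (hp : 1 < p) :
    StrictAnti φ :=
  strictAnti_of_hasDerivAt_neg h.left
    fun ζ => neg_neg_of_pos (div_pos (h.flux_pos hκ hp ζ) (expWeight_pos m ζ))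

theorem IsProfile.tendsto_atBot (h : IsProfile m κ p φ M) (hκ : 0 ≤ κ) (hp : 1 ≤ p) :
    Tendsto φ atBot (𝓝 1) := by
  refine tendsto_order.2 ⟨fun a ha => ?_, fun a ha =>
    Filter.Eventually.of_forall fun ζ => (h.mem ζ).2.trans_lt ha⟩
  obtain ⟨z, -, hz⟩ := h.near_one (1 - a) (by linarith) 0
  filter_upwards [eventually_le_atBot z] with ζ hζ
  have := h.antitone hκ hp hζ
  linarith

theorem IsProfile.tendsto_atTop (h : IsProfile m κ p φ M) (hκ : 0 ≤ κ) (hp : 1 ≤ p) :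
    Tendsto φ atTop (𝓝 0) := by
  refine tendsto_order.2 ⟨fun a ha => Filter.Eventually.of_forall fun ζ =>
    ha.trans_le (h.mem ζ).1, fun a ha => ?_⟩
  obtain ⟨z, hz0, hz⟩ := h.near_zero a ha 0
  filter_upwards [eventually_ge_atTop z] with ζ hζ
  have h1 := h.antitone hκ hp hζ
  have h2 : Real.exp (-(2 * z)) ≤ 1 := Real.exp_le_one_iff.2 (by linarith)
  have : a * Real.exp (-(2 * z)) ≤ a := mul_le_of_le_one_right ha.le h2
  linarith

/-! ### Behaviour at `-∞` -/

theorem inv_expWeight_le_exp (m ζ : ℝ) : (expWeight m ζ)⁻¹ ≤ Real.exp (m * ζ) := by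
  rw [inv_expWeight]
  gcongr
  linarith [Real.exp_pos (2 * ζ)]

theorem exp_le_inv_expWeight (m : ℝ) {ζ : ℝ} (hζ : ζ ≤ 0) :
    Real.exp (m * ζ) ≤ Real.exp (1 / 4) * (expWeight m ζ)⁻¹ := by
  rw [inv_expWeight, ← Real.exp_add]
  have : Real.exp (2 * ζ) ≤ 1 := Real.exp_le_one_iff.2 (by linarith)
  gcongr
  linarith

theorem hasDerivAt_exp_mul (m ζ : ℝ) :
    HasDerivAt (fun ζ : ℝ => Real.exp (m * ζ)) (m * Real.exp (m * ζ)) ζ := by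
  have := ((hasDerivAt_id ζ).const_mul m).exp
  exact this.congr_deriv (by simp [mul_comm])

theorem tendsto_exp_mul_atBot {m : ℝ} (hm : 0 < m) :
    Tendsto (fun ζ : ℝ => Real.exp (m * ζ)) atBot (𝓝 0) :=
  Real.tendsto_exp_atBot.comp (tendsto_id.const_mul_atBot hm)

/-- Bound `M` by `M 0` and integrate `φ' = -M / ρ` from `-∞`. -/
theorem IsProfile.one_sub_le_exp (h : IsProfile m κ p φ M) (hκ : 0 ≤ κ) (hp : 1 ≤ p) (hm : 0 < m)
    {ζ : ℝ} (hζ : ζ ≤ 0) : 1 - φ ζ ≤ M 0 / m * Real.exp (m * ζ) := by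
  have hanti : ∀ y ≤ ζ, 1 - φ ζ - M 0 / m * Real.exp (m * ζ)
      ≤ 1 - φ y - M 0 / m * Real.exp (m * y) := fun y hy => by
    refine antitoneOn_Icc_of_hasDerivAt (a := y) (b := ζ)
      (f := fun x => 1 - φ x - M 0 / m * Real.exp (m * x))
      (fun x _ => ((h.left x).const_sub 1).sub ((hasDerivAt_exp_mul m x).const_mul (M 0 / m)))
      (fun x hx => ?_) ⟨le_rfl, hy⟩ ⟨hy, le_rfl⟩ hy
    have h1 : M x ≤ M 0 := h.toIsFlow.monotone_right hκ hp (hx.2.trans hζ)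
    have h2 : M x / expWeight m x ≤ M 0 * Real.exp (m * x) := by
      rw [div_eq_mul_inv]
      exact mul_le_mul h1 (inv_expWeight_le_exp m x) (inv_pos.2 (expWeight_pos m x)).le
        (h.flux_nonneg hκ hp 0)
    have h3 : M 0 / m * (m * Real.exp (m * x)) = M 0 * Real.exp (m * x) := by field_simp
    linarith
  have hlim : Tendsto (fun y => 1 - φ y - M 0 / m * Real.exp (m * y)) atBot (𝓝 0) := by
    simpa using ((h.tendsto_atBot hκ hp).const_sub 1).sub
      ((tendsto_exp_mul_atBot hm).const_mul (M 0 / m))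
  have := ge_of_tendsto hlim ((eventually_le_atBot ζ).mono hanti)
  linarith

/-- A flux bounded below near `-∞` forces `1 - φ` to be at least of order `e^{mζ}`. -/
theorem IsProfile.exp_le_one_sub (h : IsProfile m κ p φ M) (hκ : 0 ≤ κ) (hp : 1 ≤ p) (hm : 0 < m)
    {δ : ℝ} (hM : ∀ ζ ≤ 0, δ ≤ M ζ) {ζ : ℝ} (hζ : ζ ≤ 0) :
    δ * Real.exp (-(1 / 4)) / m * Real.exp (m * ζ) ≤ 1 - φ ζ := by
  set c := δ * Real.exp (-(1 / 4)) / m with hc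
  have hmono : ∀ y ≤ ζ, 1 - φ y - c * Real.exp (m * y)
      ≤ 1 - φ ζ - c * Real.exp (m * ζ) := fun y hy => by
    refine monotoneOn_Icc_of_hasDerivAt (a := y) (b := ζ)
      (f := fun x => 1 - φ x - c * Real.exp (m * x))
      (fun x _ => ((h.left x).const_sub 1).sub ((hasDerivAt_exp_mul m x).const_mul c))
      (fun x hx => ?_) ⟨le_rfl, hy⟩ ⟨hy, le_rfl⟩ hy
    have hx0 := hx.2.trans hζ
    have h2 : δ * (Real.exp (-(1 / 4)) * Real.exp (m * x)) ≤ M x / expWeight m x := by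
      rw [div_eq_mul_inv]
      refine mul_le_mul (hM x hx0) ?_ (by positivity) (h.flux_nonneg hκ hp x)
      rw [Real.exp_neg, inv_mul_le_iff₀ (Real.exp_pos _)]
      exact exp_le_inv_expWeight m hx0
    have h3 : c * (m * Real.exp (m * x)) = δ * (Real.exp (-(1 / 4)) * Real.exp (m * x)) := by
      rw [hc]; field_simp
    linarith
  have hlim : Tendsto (fun y => 1 - φ y - c * Real.exp (m * y)) atBot (𝓝 0) := by
    simpa using ((h.tendsto_atBot hκ hp).const_sub 1).sub
      ((tendsto_exp_mul_atBot hm).const_mul c)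
  have := le_of_tendsto hlim ((eventually_le_atBot ζ).mono hmono)
  linarith

/-- `1 - u^(p-1)` is comparable to `1 - u`, by concavity or convexity of the power. -/
theorem min_mul_one_sub_le {p u : ℝ} (hp : 1 < p) (h0 : 0 ≤ u) (h1 : u ≤ 1) :
    min 1 (p - 1) * (1 - u) ≤ 1 - u ^ (p - 1) := by
  rcases le_total 1 (p - 1) with h | h
  · rw [min_eq_left h, one_mul]
    have := Real.rpow_le_self_of_le_one h0 h1 h
    linarith
  · rw [min_eq_right h]
    have := rpow_one_add_le_one_add_mul_self (s := u - 1) (by linarith) (by linarith) h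
    rw [add_sub_cancel] at this
    linarith

/-- If the flux had a positive limit at `-∞`, then `1 - φ` would be of order `e^{mζ}`, so that
`M'` would be bounded below by a positive constant near `-∞`, which is absurd. -/
theorem IsProfile.flux_tendsto_atBot (h : IsProfile m κ p φ M) (hκ : 0 < κ) (hp : 1 < p)
    (hm : 0 < m) : Tendsto M atBot (𝓝 0) := by
  refine tendsto_order.2 ⟨fun a ha => Filter.Eventually.of_forall fun ζ =>
    ha.trans_le (h.flux_nonneg hκ.le hp.le ζ), fun δ hδ => ?_⟩
  by_cases hex : ∃ z, M z < δ
  · obtain ⟨z, hz⟩ := hex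
    filter_upwards [eventually_le_atBot z] with ζ hζ
    exact (h.toIsFlow.monotone_right hκ.le hp.le hζ).trans_lt hz
  exfalso
  push Not at hex
  obtain ⟨z, hz0, hz⟩ := h.near_one (1 / 2) (by norm_num) 0
  set c := κ * (1 / 2) * (min 1 (p - 1) * (δ * Real.exp (-(1 / 4)) / m)) with hc
  have hminpos : 0 < min 1 (p - 1) := lt_min one_pos (by linarith)
  have hcpos : 0 < c := by positivity
  have hlow : ∀ x ≤ z, c ≤ expWeight m x * reaction κ p (φ x) := by
    intro x hx
    have hx0 := hx.trans hz0
    have h1 := h.exp_le_one_sub hκ.le hp.le hm (fun ζ _ => hex ζ) hx0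
    have h2 := min_mul_one_sub_le hp (h.mem x).1 (h.mem x).2
    have h3 : 1 / 2 ≤ φ x := by have := h.antitone hκ.le hp.le hx; linarith
    have h4 : 1 ≤ expWeight m x * Real.exp (m * x) := by
      have := inv_expWeight_le_exp m x
      rwa [inv_le_iff_one_le_mul₀' (expWeight_pos m x)] at this
    have h5 : φ x ^ p = φ x * φ x ^ (p - 1) := by
      rw [← Real.rpow_one_add' (h.mem x).1 (by linarith)]; ring_nf
    have hpx := h.pos hp.le x
    rw [h.reaction_eq, h5]
    calc c ≤ c * (expWeight m x * Real.exp (m * x)) := le_mul_of_one_le_right hcpos.le h4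
      _ = expWeight m x * (κ * (1 / 2 * (min 1 (p - 1) *
            (δ * Real.exp (-(1 / 4)) / m * Real.exp (m * x))))) := by rw [hc]; ring
      _ ≤ expWeight m x * (κ * (φ x * (1 - φ x ^ (p - 1)))) := by
        have := expWeight_pos m x
        have h6 : min 1 (p - 1) * (δ * Real.exp (-(1 / 4)) / m * Real.exp (m * x))
            ≤ 1 - φ x ^ (p - 1) := (mul_le_mul_of_nonneg_left h1 hminpos.le).trans h2
        gcongr
      _ = _ := by ring
  -- integrating, `M` decreases without bound to the left
  have hlin : ∀ x ≤ z, c * (z - x) ≤ M z := by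
    intro x hx
    have := monotoneOn_Icc_of_hasDerivAt (a := x) (b := z) (f := fun y => M y - c * y)
      (fun y _ => (h.right y).sub ((hasDerivAt_id y).const_mul c))
      (fun y hy => by have := hlow y hy.2; simp only [mul_one]; linarith)
      ⟨le_rfl, hx⟩ ⟨hx, le_rfl⟩ hx
    have h1 := h.flux_nonneg hκ.le hp.le x
    simp only at this
    linarith
  have h2 := hlin (z - (M z + 1) / c) (by
    have := div_pos (a := M z + 1) (by linarith [h.flux_nonneg hκ.le hp.le z]) hcpos
    linarith)
  have h3 : c * (z - (z - (M z + 1) / c)) = M z + 1 := by field_simp; ring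
  linarith

/-! ### Behaviour at `+∞` -/

/-- With `b` the drift, `φ' + (b/2) φ` is nondecreasing for large `ζ`. Were it positive somewhere,
`φ` would be bounded below by a multiple of `e^{-2ζ}`; so it is nonpositive, which is fast decay. -/
theorem IsProfile.exists_le_flux (h : IsProfile m κ p φ M) (hκ : 0 ≤ κ) (hp : 1 ≤ p)
    (hm : 0 ≤ m) :
    ∃ Z, ∀ ζ ≥ Z, φ ζ * expWeight m ζ ≤ 8 * (Real.exp (-(2 * ζ)) * M ζ) := by
  obtain ⟨Z, hZ⟩ : ∃ Z : ℝ, ∀ ζ ≥ Z, 2 * m ≤ Real.exp (2 * ζ) / 2 ∧ κ ≤ Real.exp (2 * ζ) / 2 := by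
    have h1 : Tendsto (fun z : ℝ => Real.exp (2 * z) / 2) atTop atTop :=
      (Real.tendsto_exp_atTop.comp (tendsto_id.const_mul_atTop two_pos)).atTop_div_const two_pos
    exact eventually_atTop.1
      ((h1.eventually_ge_atTop (2 * m)).and (h1.eventually_ge_atTop κ))
  set E : ℝ → ℝ := fun ζ => -(M ζ / expWeight m ζ) + (Real.exp (2 * ζ) / 2 - m) / 2 * φ ζ with hE
  have hEd : ∀ x, HasDerivAt E (-reaction κ p (φ x) + (Real.exp (2 * x) / 2 - m) / 2 *
      (M x / expWeight m x) + Real.exp (2 * x) / 2 * φ x) x := by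
    intro x
    have h3 := (h.right x).div (hasDerivAt_expWeight m x) (expWeight_pos m x).ne'
    refine (h3.neg.add (((((hasDerivAt_exp_mul 2 x).div_const 2).sub_const m).div_const 2).mul
      (h.left x))).congr_deriv ?_
    have := (expWeight_pos m x).ne'
    field_simp
    ring
  have hmono : ∀ x y, Z ≤ x → x ≤ y → E x ≤ E y := fun x y hx hxy =>
    monotoneOn_Icc_of_hasDerivAt (fun z _ => hEd z) (fun z hz => by
      obtain ⟨h1, h2⟩ := hZ z (hx.trans hz.1)
      have h3 := h.reaction_le_mul hκ z
      have h4 := mul_le_mul_of_nonneg_right h2 (h.mem z).1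
      have h5 : 0 ≤ (Real.exp (2 * z) / 2 - m) / 2 * (M z / expWeight m z) :=
        mul_nonneg (by linarith) (div_nonneg (h.flux_nonneg hκ hp z) (expWeight_pos m z).le)
      linarith) ⟨le_rfl, hxy⟩ ⟨hxy, le_rfl⟩ hxy
  have hneg : ∀ x, Z ≤ x → E x ≤ 0 := by
    intro x hx
    by_contra! hpos
    obtain ⟨y, hy, hy'⟩ := h.near_zero (4 * E x) (by linarith) x
    have h1 := hmono x y hx hy
    have h2 : E y ≤ Real.exp (2 * y) / 4 * φ y := by
      have h3 := div_nonneg (h.flux_nonneg hκ hp y) (expWeight_pos m y).le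
      have h4 := mul_nonneg hm (h.mem y).1
      simp only [hE]
      linarith
    have h5 := mul_lt_mul_of_pos_left hy' (Real.exp_pos (2 * y))
    have h6 : Real.exp (2 * y) * Real.exp (-(2 * y)) = 1 := by
      rw [← Real.exp_add, add_neg_cancel, Real.exp_zero]
    have h7 : Real.exp (2 * y) * (4 * E x * Real.exp (-(2 * y))) = 4 * E x := by
      linear_combination 4 * E x * h6
    linarith
  refine ⟨Z, fun ζ hζ => ?_⟩
  have h1 := hneg ζ hζ
  have hw := expWeight_pos m ζ
  obtain ⟨h2, -⟩ := hZ ζ hζ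
  have h3 : Real.exp (2 * ζ) / 8 * φ ζ ≤ M ζ / expWeight m ζ := by
    have h4 : Real.exp (2 * ζ) / 8 * φ ζ ≤ (Real.exp (2 * ζ) / 2 - m) / 2 * φ ζ :=
      mul_le_mul_of_nonneg_right (by linarith) (h.mem ζ).1
    simp only [hE] at h1
    linarith
  rw [le_div_iff₀ hw] at h3
  have h4 := mul_le_mul_of_nonneg_left h3 (Real.exp_pos (-(2 * ζ))).le
  have h6 : Real.exp (-(2 * ζ)) * Real.exp (2 * ζ) = 1 := by
    rw [← Real.exp_add, neg_add_cancel, Real.exp_zero]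
  have h7 : Real.exp (-(2 * ζ)) * (Real.exp (2 * ζ) / 8 * φ ζ * expWeight m ζ)
      = φ ζ * expWeight m ζ / 8 := by
    linear_combination φ ζ * expWeight m ζ / 8 * h6
  linarith

/-- The flux is bounded: by `exists_le_flux` it satisfies `M' ≤ 8 κ e^{-2ζ} M` for large `ζ`. -/
theorem IsProfile.exists_flux_le (h : IsProfile m κ p φ M) (hκ : 0 ≤ κ) (hp : 1 ≤ p)
    (hm : 0 ≤ m) : ∃ B, 0 ≤ B ∧ ∀ ζ, M ζ ≤ B := by
  obtain ⟨Z, hZ⟩ := h.exists_le_flux hκ hp hm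
  -- Grönwall with the integrable rate `8 κ e^{-2ζ}`
  set e : ℝ → ℝ := fun ζ => Real.exp (4 * κ * Real.exp (-2 * ζ)) with he
  have hed : ∀ x, HasDerivAt e (e x * (4 * κ * (-2 * Real.exp (-2 * x)))) x := fun x =>
    ((hasDerivAt_exp_mul (-2) x).const_mul (4 * κ)).exp
  have hB : ∀ ζ ≥ Z, M ζ ≤ M Z * e Z := by
    intro ζ hζ
    have h1 := antitoneOn_Icc_of_hasDerivAt (a := Z) (b := ζ)
      (fun x _ => (h.right x).mul (hed x)) (fun x hx => by
        have h2 := hZ x hx.1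
        have h3 := mul_le_mul_of_nonneg_left (h.reaction_le_mul hκ x) (expWeight_pos m x).le
        have h4 := mul_le_mul_of_nonneg_left h2 hκ
        have h5 : 0 ≤ e x := (Real.exp_pos _).le
        have h6 : expWeight m x * reaction κ p (φ x) ≤ 8 * κ * Real.exp (-2 * x) * M x := by
          rw [neg_mul]
          nlinarith
        have h7 := mul_le_mul_of_nonneg_right h6 h5
        nlinarith) ⟨le_rfl, hζ⟩ ⟨hζ, le_rfl⟩ hζ
    refine le_trans ?_ h1
    refine le_mul_of_one_le_right (h.flux_nonneg hκ hp ζ) (Real.one_le_exp ?_)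
    positivity
  have hMe : 0 ≤ M Z * e Z := mul_nonneg (h.flux_nonneg hκ hp Z) (Real.exp_pos _).le
  refine ⟨M Z * e Z, hMe, fun ζ => ?_⟩
  exact (h.toIsFlow.monotone_right hκ hp (le_max_left ζ Z)).trans (hB _ (le_max_right ζ Z))

theorem IsProfile.exists_flux_tendsto_atTop (h : IsProfile m κ p φ M) (hκ : 0 < κ) (hp : 1 < p)
    (hm : 0 ≤ m) : ∃ L, 0 < L ∧ Tendsto M atTop (𝓝 L) := by
  obtain ⟨B, -, hB⟩ := h.exists_flux_le hκ.le hp.le hm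
  have hlim := tendsto_atTop_ciSup (h.toIsFlow.monotone_right hκ.le hp.le)
    ⟨B, by rintro _ ⟨ζ, rfl⟩; exact hB ζ⟩
  exact ⟨_, (h.flux_pos hκ hp 0).trans_le (ge_of_tendsto hlim
    ((eventually_ge_atTop 0).mono fun ζ hζ => h.toIsFlow.monotone_right hκ.le hp.le hζ)), hlim⟩

/-- The exact decay at `+∞`, by l'Hôpital's rule from the limit of the flux. -/
theorem IsProfile.exists_tendsto_div (h : IsProfile m κ p φ M) (hκ : 0 < κ) (hp : 1 < p)
    (hm : 0 ≤ m) : ∃ C, 0 < C ∧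
      Tendsto (fun ζ => φ ζ / (Real.exp (-2 * ζ) / expWeight m ζ)) atTop (𝓝 C) := by
  obtain ⟨L, hL, hlim⟩ := h.exists_flux_tendsto_atTop hκ hp hm
  have hexp : Tendsto (fun ζ : ℝ => Real.exp (-2 * ζ)) atTop (𝓝 0) :=
    Real.tendsto_exp_atBot.comp (tendsto_id.const_mul_atTop_of_neg (by norm_num))
  have hden : Tendsto (fun ζ : ℝ => 1 / 2 + (2 - m) * Real.exp (-2 * ζ)) atTop (𝓝 (1 / 2)) := by
    have := (hexp.const_mul (2 - m)).const_add (1 / 2)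
    rwa [mul_zero, add_zero] at this
  have hee : ∀ ζ : ℝ, Real.exp (-(2 * ζ)) * Real.exp (2 * ζ) = 1 := fun ζ => by
    rw [← Real.exp_add, neg_add_cancel, Real.exp_zero]
  refine ⟨L / (1 / 2), by positivity, ?_⟩
  refine HasDerivAt.lhopital_zero_atTop (f' := fun ζ => -(M ζ / expWeight m ζ))
    (g' := fun ζ => -((1 / 2 + (2 - m) * Real.exp (-2 * ζ)) / expWeight m ζ))
    (Filter.Eventually.of_forall h.left) (Filter.Eventually.of_forall fun ζ => ?_) ?_
    (h.tendsto_atTop hκ.le hp.le) (tendsto_exp_div_expWeight_atTop m (-2)) ?_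
  · refine ((hasDerivAt_exp_mul (-2) ζ).div (hasDerivAt_expWeight m ζ)
      (expWeight_pos m ζ).ne').congr_deriv ?_
    have := (expWeight_pos m ζ).ne'
    field_simp
    linear_combination -hee ζ
  · filter_upwards [hden.eventually_const_lt (show (0 : ℝ) < 1 / 2 by norm_num)] with ζ hζ
    exact (neg_neg_of_pos (div_pos hζ (expWeight_pos m ζ))).ne
  · refine (hlim.div hden (by norm_num)).congr fun ζ => ?_
    rw [neg_div_neg_eq, div_div_div_cancel_right₀ (expWeight_pos m ζ).ne']
    rfl

theorem IsProfile.deriv_eq (h : IsProfile m κ p φ M) :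
    deriv φ = fun ζ => -(M ζ / expWeight m ζ) := funext fun ζ => (h.left ζ).deriv

theorem IsProfile.deriv_tendsto_atTop (h : IsProfile m κ p φ M) (hκ : 0 < κ) (hp : 1 < p)
    (hm : 0 ≤ m) : Tendsto (deriv φ) atTop (𝓝 0) := by
  obtain ⟨L, -, hlim⟩ := h.exists_flux_tendsto_atTop hκ hp hm
  rw [h.deriv_eq]
  have := (hlim.mul (tendsto_exp_div_expWeight_atTop m 0)).neg
  simpa [div_eq_mul_inv] using this

theorem IsProfile.deriv_tendsto_atBot (h : IsProfile m κ p φ M) (hκ : 0 < κ) (hp : 1 < p)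
    (hm : 0 < m) : Tendsto (deriv φ) atBot (𝓝 0) := by
  have hw : Tendsto (fun ζ => (expWeight m ζ)⁻¹) atBot (𝓝 0) :=
    squeeze_zero (fun ζ => (inv_pos.2 (expWeight_pos m ζ)).le) (inv_expWeight_le_exp m)
      (tendsto_exp_mul_atBot hm)
  rw [h.deriv_eq]
  simpa [div_eq_mul_inv] using ((h.flux_tendsto_atBot hκ hp hm).mul hw).neg

/-! ### Regularity and the second order equation -/

/-- Bootstrap in the first order system; `u ↦ u^p` is smooth on the positive values of `φ`. -/
theorem IsProfile.contDiff (h : IsProfile m κ p φ M) (hp : 1 ≤ p) : ContDiff ℝ ∞ φ := by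
  have hM : M = fun ζ => -(expWeight m ζ * deriv φ ζ) := by
    ext ζ
    rw [h.deriv_eq]
    have := (expWeight_pos m ζ).ne'
    field_simp
  have key : ∀ n : ℕ, ContDiff ℝ n φ ∧ ContDiff ℝ n M := by
    intro n
    induction n with
    | zero =>
      refine ⟨contDiff_zero.2 ?_, contDiff_zero.2 ?_⟩
      · exact continuous_iff_continuousAt.2 fun ζ => (h.left ζ).continuousAt
      · exact continuous_iff_continuousAt.2 fun ζ => (h.right ζ).continuousAt
    | succ n ih =>
      obtain ⟨h1, h2⟩ := ih
      have hw : ∀ ζ, expWeight m ζ ≠ 0 := fun ζ => (expWeight_pos m ζ).ne'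
      push_cast
      constructor
      · refine contDiff_succ_iff_deriv.2 ⟨fun ζ => (h.left ζ).differentiableAt, by simp, ?_⟩
        rw [h.deriv_eq]
        exact (h2.div (contDiff_expWeight m) hw).neg
      · refine contDiff_succ_iff_deriv.2 ⟨fun ζ => (h.right ζ).differentiableAt, by simp, ?_⟩
        have : deriv M = fun ζ => expWeight m ζ * (κ * (φ ζ - φ ζ ^ p)) :=
          funext fun ζ => by rw [(h.right ζ).deriv, h.reaction_eq]
        rw [this]
        exact (contDiff_expWeight m).mul (contDiff_const.mul
          (h1.sub (h1.rpow_const_of_ne fun ζ => (h.pos hp ζ).ne')))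
  exact contDiff_infty.2 fun n => (key n).1

theorem IsProfile.deriv_deriv (h : IsProfile m κ p φ M) (ζ : ℝ) :
    deriv (deriv φ) ζ + (Real.exp (2 * ζ) / 2 - m) * deriv φ ζ + κ * (φ ζ - φ ζ ^ p) = 0 := by
  have h3 := ((h.right ζ).div (hasDerivAt_expWeight m ζ) (expWeight_pos m ζ).ne').neg
  have h4 := h3.deriv
  have h5 : deriv φ = -(M / expWeight m) := h.deriv_eq
  rw [← h5] at h4
  rw [h4, h.deriv_eq, h.reaction_eq]
  have := (expWeight_pos m ζ).ne'
  field_simp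
  ring

/-- All quantities that enter the norm of `H¹(ℝ, dμ)` are bounded by a multiple of `1 / ρ`. -/
theorem IsProfile.exists_bounds (h : IsProfile m κ p φ M) (hκ : 0 < κ) (hp : 1 < p)
    (hm : 0 < m) : ∃ C, (∀ ζ ≤ 0, 1 - φ ζ ≤ C * (expWeight m ζ)⁻¹) ∧
      (∀ ζ ≥ 0, φ ζ ≤ C * (expWeight m ζ)⁻¹) ∧ ∀ ζ, |deriv φ ζ| ≤ C * (expWeight m ζ)⁻¹ := by
  obtain ⟨B, hB0, hB⟩ := h.exists_flux_le hκ.le hp.le hm.le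
  obtain ⟨Z, hZ⟩ := h.exists_le_flux hκ.le hp.le hm.le
  obtain ⟨D, hD⟩ := isCompact_Icc.bddAbove_image
    ((continuous_expWeight m).continuousOn (s := Set.Icc 0 (max Z 0)))
  have hw : ∀ ζ, 0 ≤ (expWeight m ζ)⁻¹ := fun ζ => (inv_pos.2 (expWeight_pos m ζ)).le
  refine ⟨max (M 0 / m * Real.exp (1 / 4)) (max (8 * B) (max D B)), fun ζ hζ => ?_, fun ζ hζ => ?_,
    fun ζ => ?_⟩
  · refine (h.one_sub_le_exp hκ.le hp.le hm hζ).trans ?_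
    refine le_trans ?_ (mul_le_mul_of_nonneg_right (le_max_left _ _) (hw ζ))
    rw [mul_assoc]
    exact mul_le_mul_of_nonneg_left (exp_le_inv_expWeight m hζ)
      (div_nonneg (h.flux_nonneg hκ.le hp.le 0) hm.le)
  · rw [← div_eq_mul_inv, le_div_iff₀ (expWeight_pos m ζ)]
    rcases le_total ζ (max Z 0) with h1 | h1
    · have h2 : expWeight m ζ ≤ D := hD ⟨ζ, ⟨hζ, h1⟩, rfl⟩
      refine (mul_le_of_le_one_left (expWeight_pos m ζ).le (h.mem ζ).2).trans (h2.trans ?_)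
      exact ((le_max_left _ _).trans (le_max_right _ _)).trans (le_max_right _ _)
    · refine (hZ ζ ((le_max_left _ _).trans h1)).trans ?_
      refine le_trans ?_ ((le_max_left (8 * B) _).trans (le_max_right _ _))
      have h3 : Real.exp (-(2 * ζ)) ≤ 1 := Real.exp_le_one_iff.2 (by linarith)
      have := mul_le_of_le_one_left (h.flux_nonneg hκ.le hp.le ζ) h3
      linarith [hB ζ]
  · rw [h.deriv_eq, abs_neg, abs_of_nonneg (div_nonneg (h.flux_nonneg hκ.le hp.le ζ)
      (expWeight_pos m ζ).le), div_eq_mul_inv]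
    refine mul_le_mul_of_nonneg_right ((hB ζ).trans ?_) (hw ζ)
    exact ((le_max_right _ _).trans (le_max_right _ _)).trans (le_max_right _ _)

/-! ### Uniqueness of profiles -/

/-- The Wronskian `ρ (φ' ψ - ψ' φ)` of two profiles grows wherever `φ ≥ ψ`, because
`u ↦ (u - u^p) / u` is decreasing. -/
theorem IsProfile.hasDerivAt_wronskian {ψ N : ℝ → ℝ} (h : IsProfile m κ p φ M)
    (h' : IsProfile m κ p ψ N) (hp : 1 < p) (ζ : ℝ) :
    HasDerivAt (fun ζ => N ζ * φ ζ - M ζ * ψ ζ)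
      (expWeight m ζ * κ * (φ ζ * ψ ζ * (φ ζ ^ (p - 1) - ψ ζ ^ (p - 1)))) ζ := by
  refine (((h'.right ζ).mul (h.left ζ)).sub ((h.right ζ).mul (h'.left ζ))).congr_deriv ?_
  have hpow : ∀ u : ℝ, 0 ≤ u → u ^ p = u * u ^ (p - 1) := fun u hu => by
    rw [← Real.rpow_one_add' hu (by linarith)]; ring_nf
  rw [h.reaction_eq, h'.reaction_eq, hpow _ (h.mem ζ).1, hpow _ (h'.mem ζ).1]
  have := (expWeight_pos m ζ).ne'
  field_simp
  ring

theorem IsProfile.hasDerivAt_ratio {ψ N : ℝ → ℝ} (h : IsProfile m κ p φ M)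
    (h' : IsProfile m κ p ψ N) (hp : 1 < p) (ζ : ℝ) :
    HasDerivAt (fun ζ => φ ζ / ψ ζ)
      ((N ζ * φ ζ - M ζ * ψ ζ) / (expWeight m ζ * ψ ζ ^ 2)) ζ := by
  refine ((h.left ζ).div (h'.left ζ) (h'.pos hp.le ζ).ne').congr_deriv ?_
  have := (expWeight_pos m ζ).ne'
  have := (h'.pos hp.le ζ).ne'
  field_simp
  ring

/-- Where `φ > ψ`, the Wronskian increases; so the ratio `φ / ψ` keeps growing in one of the two
directions, and the Wronskian cannot vanish at that end of the line. -/
theorem IsProfile.le {ψ N : ℝ → ℝ} (h : IsProfile m κ p φ M)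
    (h' : IsProfile m κ p ψ N) (hκ : 0 < κ) (hp : 1 < p) (hm : 0 < m) (x : ℝ) : φ x ≤ ψ x := by
  by_contra! hx
  set W : ℝ → ℝ := fun ζ => N ζ * φ ζ - M ζ * ψ ζ with hW
  set W' : ℝ → ℝ := fun ζ =>
    expWeight m ζ * κ * (φ ζ * ψ ζ * (φ ζ ^ (p - 1) - ψ ζ ^ (p - 1))) with hW'
  have hWd : ∀ ζ, HasDerivAt W (W' ζ) ζ := h.hasDerivAt_wronskian h' hp
  have hrd := h.hasDerivAt_ratio h' hp
  have hcφ : Continuous φ := continuous_iff_continuousAt.2 fun ζ => (h.left ζ).continuousAt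
  have hcψ : Continuous ψ := continuous_iff_continuousAt.2 fun ζ => (h'.left ζ).continuousAt
  have hW0 : ∀ ζ, ψ ζ ≤ φ ζ → 0 ≤ W' ζ := fun ζ hζ => by
    have h1 := Real.rpow_le_rpow (h'.mem ζ).1 hζ (by linarith : 0 ≤ p - 1)
    exact mul_nonneg (mul_nonneg (expWeight_pos m ζ).le hκ.le)
      (mul_nonneg (mul_nonneg (h.mem ζ).1 (h'.mem ζ).1) (by linarith))
  have hWpos : ∀ ζ, ψ ζ < φ ζ → 0 < W' ζ := fun ζ hζ => by
    have h1 := Real.rpow_lt_rpow (h'.mem ζ).1 hζ (by linarith : 0 < p - 1)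
    exact mul_pos (mul_pos (expWeight_pos m ζ) hκ)
      (mul_pos (mul_pos (h.pos hp.le ζ) (h'.pos hp.le ζ)) (by linarith))
  have hden : ∀ ζ, 0 < expWeight m ζ * ψ ζ ^ 2 := fun ζ =>
    mul_pos (expWeight_pos m ζ) (pow_pos (h'.pos hp.le ζ) 2)
  have hratio : 1 < φ x / ψ x := (one_lt_div (h'.pos hp.le x)).2 hx
  obtain ⟨B, -, hB⟩ := h.exists_flux_tendsto_atTop hκ hp hm.le
  obtain ⟨B', -, hB'⟩ := h'.exists_flux_tendsto_atTop hκ hp hm.le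
  have hWtop : Tendsto W atTop (𝓝 0) := by
    simpa using (hB'.mul (h.tendsto_atTop hκ.le hp.le)).sub
      (hB.mul (h'.tendsto_atTop hκ.le hp.le))
  have hWbot : Tendsto W atBot (𝓝 0) := by
    simpa using ((h'.flux_tendsto_atBot hκ hp hm).mul (h.tendsto_atBot hκ.le hp.le)).sub
      ((h.flux_tendsto_atBot hκ hp hm).mul (h'.tendsto_atBot hκ.le hp.le))
  rcases le_or_gt 0 (W x) with hWx | hWx
  -- `W x ≥ 0`: to the right of `x`, `W` is positive and increasing, but tends to `0`
  · have hgt : ∀ y ≥ x, ψ y < φ y := by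
      by_contra! hcon
      obtain ⟨y₀, hy₀, hy₀'⟩ := hcon
      -- the first point after `x` at which the two profiles meet
      set S := {y | x ≤ y ∧ φ y ≤ ψ y} with hS
      have hSc : IsClosed S := (isClosed_le continuous_const continuous_id).inter
        (isClosed_le hcφ hcψ)
      have hSb : BddBelow S := ⟨x, fun y hy => hy.1⟩
      have hyS : sInf S ∈ S := hSc.csInf_mem ⟨y₀, hy₀, hy₀'⟩ hSb
      set y := sInf S
      have hbefore : ∀ z ∈ Set.Icc x y, ψ z ≤ φ z := by
        intro z hz
        rcases eq_or_lt_of_le hz.2 with rfl | hlt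
        · refine le_of_tendsto_of_tendsto (hcψ.continuousWithinAt (s := Set.Iio y) (x := y))
            (hcφ.continuousWithinAt (s := Set.Iio y) (x := y)) ?_
          have hxz : x < y := lt_of_le_of_ne hz.1
            (by intro he; rw [← he] at hyS; exact absurd hyS.2 (not_le.2 hx))
          filter_upwards [Ioo_mem_nhdsLT hxz] with w hw
          by_contra! hc
          exact absurd (csInf_le hSb ⟨hw.1.le, hc.le⟩) (not_le.2 hw.2)
        · by_contra! hc
          exact absurd (csInf_le hSb ⟨hz.1, hc.le⟩) (not_le.2 hlt)
      have hWmono := monotoneOn_Icc_of_hasDerivAt (fun z _ => hWd z)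
        (fun z hz => hW0 z (hbefore z hz))
      have hxI : x ∈ Set.Icc x y := ⟨le_rfl, hyS.1⟩
      have hrmono := monotoneOn_Icc_of_hasDerivAt (a := x) (b := y) (fun z _ => hrd z)
        (fun z hz => div_nonneg (hWx.trans (hWmono hxI hz hz.1)) (hden z).le)
      have := hrmono hxI ⟨hyS.1, le_rfl⟩ hyS.1
      have h2 : φ y / ψ y ≤ 1 := (div_le_one (h'.pos hp.le y)).2 hyS.2
      simp only at this
      linarith
    have hsm : StrictMonoOn W (Set.Ici x) :=
      strictMonoOn_of_hasDerivWithinAt_pos (convex_Ici x)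
        (fun z _ => (hWd z).continuousAt.continuousWithinAt) (fun z _ => (hWd z).hasDerivWithinAt)
        (fun z hz => hWpos z (hgt z (interior_subset hz)))
    have h1 : W x < W (x + 1) :=
      hsm Set.self_mem_Ici (Set.mem_Ici.2 (by linarith)) (by linarith)
    have h2 : W (x + 1) ≤ 0 := ge_of_tendsto hWtop (by
      filter_upwards [eventually_ge_atTop (x + 1)] with z hz
      exact hsm.monotoneOn (Set.mem_Ici.2 (by linarith)) (Set.mem_Ici.2 (by linarith)) hz)
    linarith
  -- `W x < 0`: to the left of `x`, `W` is at most `W x`, but tends to `0`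
  · have hgt : ∀ y ≤ x, ψ y ≤ φ y := by
      by_contra! hcon
      obtain ⟨y₀, hy₀, hy₀'⟩ := hcon
      set S := {y | y ≤ x ∧ φ y ≤ ψ y} with hS
      have hSc : IsClosed S := (isClosed_le continuous_id continuous_const).inter
        (isClosed_le hcφ hcψ)
      have hSb : BddAbove S := ⟨x, fun y hy => hy.1⟩
      have hyS : sSup S ∈ S := hSc.csSup_mem ⟨y₀, hy₀, hy₀'.le⟩ hSb
      set y := sSup S
      have hbefore : ∀ z ∈ Set.Icc y x, ψ z ≤ φ z := by
        intro z hz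
        rcases eq_or_lt_of_le hz.1 with rfl | hlt
        · refine le_of_tendsto_of_tendsto (hcψ.continuousWithinAt (s := Set.Ioi y) (x := y))
            (hcφ.continuousWithinAt (s := Set.Ioi y) (x := y)) ?_
          have hxz : y < x := lt_of_le_of_ne hz.2
            (by intro he; rw [he] at hyS; exact absurd hyS.2 (not_le.2 hx))
          filter_upwards [Ioo_mem_nhdsGT hxz] with w hw
          by_contra! hc
          exact absurd (le_csSup hSb ⟨hw.2.le, hc.le⟩) (not_le.2 hw.1)
        · by_contra! hc
          exact absurd (le_csSup hSb ⟨hz.2, hc.le⟩) (not_le.2 hlt)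
      have hWmono := monotoneOn_Icc_of_hasDerivAt (fun z _ => hWd z)
        (fun z hz => hW0 z (hbefore z hz))
      have hxI : x ∈ Set.Icc y x := ⟨hyS.1, le_rfl⟩
      have hranti := antitoneOn_Icc_of_hasDerivAt (a := y) (b := x) (fun z _ => hrd z)
        (fun z hz => div_nonpos_of_nonpos_of_nonneg
          ((hWmono hz hxI hz.2).trans hWx.le) (hden z).le)
      have := hranti ⟨le_rfl, hyS.1⟩ hxI hyS.1
      have h2 : φ y / ψ y ≤ 1 := (div_le_one (h'.pos hp.le y)).2 hyS.2
      simp only at this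
      linarith
    have h2 : 0 ≤ W x := le_of_tendsto hWbot (by
      filter_upwards [eventually_le_atBot x] with z hz
      exact monotoneOn_Icc_of_hasDerivAt (fun w _ => hWd w)
        (fun w hw => hW0 w (hgt w hw.2)) ⟨le_rfl, hz⟩ ⟨hz, le_rfl⟩ hz)
    linarith

theorem IsProfile.unique {ψ N : ℝ → ℝ} (h : IsProfile m κ p φ M)
    (h' : IsProfile m κ p ψ N) (hκ : 0 < κ) (hp : 1 < p) (hm : 0 < m) : φ = ψ :=
  funext fun x => le_antisymm (h.le h' hκ hp hm x) (h'.le h hκ hp hm x)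

end Profile

/-! ### Weak derivatives on the line -/

protected theorem IsTest.continuous {w : ℝ → ℝ} (hw : IsTest w) : Continuous w := hw.1.continuous

protected theorem IsTest.hasDerivAt {w : ℝ → ℝ} (hw : IsTest w) (x : ℝ) :
    HasDerivAt w (deriv w x) x :=
  (hw.1.differentiable (by simp) x).hasDerivAt

protected theorem IsTest.deriv {w : ℝ → ℝ} (hw : IsTest w) : IsTest (deriv w) :=
  ⟨(contDiff_infty_iff_deriv.1 hw.1).2, hw.2.deriv⟩

/-- The product of a locally integrable function and a test function is integrable. -/
theorem IsTest.integrable_mul {f w : ℝ → ℝ} (hf : LocallyIntegrable f) (hw : IsTest w) :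
    Integrable fun x => f x * w x := by
  simpa [mul_comm] using hf.integrable_smul_left_of_hasCompactSupport hw.continuous hw.2

theorem IsTest.exists_eq_zero {w : ℝ → ℝ} (hw : IsTest w) :
    ∃ R : ℝ, 0 < R ∧ ∀ x, R ≤ |x| → w x = 0 := by
  obtain ⟨R, hR⟩ := hw.2.isCompact.isBounded.subset_closedBall (0 : ℝ)
  refine ⟨max R 0 + 1, by positivity, fun x hx => ?_⟩
  by_contra hne
  have := hR (subset_tsupport w hne)
  rw [mem_closedBall_zero_iff, Real.norm_eq_abs] at this
  linarith [le_max_left R 0]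

theorem integral_eq_intervalIntegral {f : ℝ → ℝ} {R : ℝ}
    (hf : ∀ x, R ≤ |x| → f x = 0) : ∫ x, f x = ∫ x in (-R)..R, f x := by
  refine (intervalIntegral.integral_eq_integral_of_support_subset fun x hx => ?_).symm
  by_contra hc
  refine hx (hf x ?_)
  by_contra! hlt
  exact hc ⟨(abs_lt.1 hlt).1, (abs_lt.1 hlt).2.le⟩

/-- A test function with vanishing integral is the derivative of a test function. -/
theorem IsTest.exists_deriv_eq {w : ℝ → ℝ} (hw : IsTest w) (h0 : ∫ x, w x = 0) :
    ∃ v, IsTest v ∧ deriv v = w := by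
  obtain ⟨R, hR, hwR⟩ := hw.exists_eq_zero
  have hd : ∀ x, HasDerivAt (fun x => ∫ t in (-R)..x, w t) (w x) x := fun x =>
    intervalIntegral.integral_hasDerivAt_right (hw.continuous.intervalIntegrable _ _)
      (hw.continuous.stronglyMeasurableAtFilter _ _) hw.continuous.continuousAt
  have hderiv : deriv (fun x => ∫ t in (-R)..x, w t) = w := funext fun x => (hd x).deriv
  refine ⟨fun x => ∫ t in (-R)..x, w t, ⟨?_, ?_⟩, hderiv⟩
  · rw [contDiff_infty_iff_deriv, hderiv]
    exact ⟨fun x => (hd x).differentiableAt, hw.1⟩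
  · refine HasCompactSupport.of_support_subset_isCompact (isCompact_Icc (a := -R) (b := R))
      fun x hx => ?_
    by_contra hc
    refine hx ?_
    rw [Set.mem_Icc, not_and_or, not_le, not_le] at hc
    rcases hc with hc | hc
    · refine intervalIntegral.integral_zero_ae (Filter.Eventually.of_forall fun t ht => hwR t ?_)
      rw [Set.uIoc_of_ge hc.le] at ht
      rw [abs_of_nonpos (by linarith [ht.2])]
      linarith [ht.2]
    · have h1 : ∫ t in R..x, w t = 0 :=
        intervalIntegral.integral_zero_ae (Filter.Eventually.of_forall fun t ht => hwR t (by
          rw [Set.uIoc_of_le hc.le] at ht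
          exact ht.1.le.trans (le_abs_self t)))
      have h2 := intervalIntegral.integral_add_adjacent_intervals
        (hw.continuous.intervalIntegrable (μ := volume) (-R) R)
        (hw.continuous.intervalIntegrable R x)
      simp only
      rw [← h2, h1, ← integral_eq_intervalIntegral hwR, h0, add_zero]

/-- Du Bois-Reymond: a function with vanishing weak derivative is constant almost everywhere. -/
theorem ae_eq_const_of_integral_mul_deriv {f : ℝ → ℝ} (hf : LocallyIntegrable f)
    (h : ∀ w, IsTest w → ∫ x, f x * deriv w x = 0) : ∃ c : ℝ, ∀ᵐ x, f x = c := by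
  let b : ContDiffBump (0 : ℝ) := ⟨1, 2, one_pos, by norm_num⟩
  have hb : IsTest (b.normed volume) := ⟨b.contDiff_normed, b.hasCompactSupport_normed⟩
  refine ⟨∫ x, f x * b.normed volume x, ?_⟩
  set c := ∫ x, f x * b.normed volume x with hc
  have : ∀ᵐ x, f x - c = 0 := by
    refine ae_eq_zero_of_integral_contDiff_smul_eq_zero
      (hf.sub (continuous_const.locallyIntegrable)) fun g hg hgs => ?_
    have hgt : IsTest g := ⟨hg, hgs⟩
    have hgi : Integrable g := hg.continuous.integrable_of_hasCompactSupport hgs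
    -- subtract a multiple of the bump to get mean zero
    obtain ⟨v, hv, hv'⟩ := IsTest.exists_deriv_eq
      (w := fun x => g x - (∫ y, g y) * b.normed volume x)
      ⟨hg.sub (contDiff_const.mul hb.1), hgs.sub hb.2.mul_left⟩ (by
        rw [integral_sub hgi (b.integrable_normed.const_mul _), integral_const_mul,
          b.integral_normed, mul_one, sub_self])
    have h1 := h v hv
    rw [hv'] at h1
    have h2 : ∫ x, f x * (g x - (∫ y, g y) * b.normed volume x)
        = (∫ x, f x * g x) - (∫ y, g y) * c := by
      rw [hc, ← integral_const_mul, ← integral_sub (hgt.integrable_mul hf)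
        ((hb.integrable_mul hf).const_mul _)]
      congr 1
      ext x
      ring
    have h3 : ∫ x, g x • (f x - c) = (∫ x, f x * g x) - (∫ y, g y) * c := by
      rw [← integral_mul_const, ← integral_sub (hgt.integrable_mul hf) (hgi.mul_const _)]
      congr 1
      ext x
      rw [smul_eq_mul]
      ring
    rw [h3, ← h2, h1]
  filter_upwards [this] with x hx
  linarith

/-- A locally integrable function with locally integrable weak derivative `g` is a primitive
of `g`. -/
theorem ae_eq_primitive_of_isWeakDeriv {f g : ℝ → ℝ} (hf : LocallyIntegrable f)
    (hg : LocallyIntegrable g) (h : IsWeakDeriv f g) :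
    ∃ c : ℝ, ∀ᵐ x, f x = c + ∫ t in (0 : ℝ)..x, g t := by
  have hgi : ∀ a b, IntervalIntegrable g volume a b := fun a b =>
    (hg.integrableOn_isCompact isCompact_uIcc).intervalIntegrable
  set G : ℝ → ℝ := fun x => ∫ t in (0 : ℝ)..x, g t with hG
  have hGc : Continuous G := intervalIntegral.continuous_primitive hgi 0
  have hibp : ∀ w, IsTest w → ∫ x, G x * deriv w x = -∫ x, g x * w x := by
    intro w hw
    obtain ⟨R, hR, hwR⟩ := hw.exists_eq_zero
    obtain ⟨R', hR', hwR'⟩ := hw.deriv.exists_eq_zero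
    set S := max R R' with hS
    have hS0 : 0 < S := lt_max_of_lt_left hR
    rw [integral_eq_intervalIntegral (R := S)
        (fun x hx => by rw [hwR' x ((le_max_right _ _).trans hx), mul_zero]),
      integral_eq_intervalIntegral (R := S)
        (fun x hx => by rw [hwR x ((le_max_left _ _).trans hx), mul_zero])]
    have hac : AbsolutelyContinuousOnInterval G (-S) S :=
      (hgi (-S) S).absolutelyContinuousOnInterval_intervalIntegral
        (by rw [Set.uIcc_of_le (by linarith)]; exact ⟨by linarith, hS0.le⟩)
    have hac' : AbsolutelyContinuousOnInterval w (-S) S :=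
      (hw.1.of_le (by exact_mod_cast le_top)).contDiffOn.absolutelyContinuousOnInterval
    rw [hac.integral_mul_deriv_eq_deriv_mul hac',
      hwR S (by rw [abs_of_pos hS0]; exact le_max_left _ _),
      hwR (-S) (by rw [abs_neg, abs_of_pos hS0]; exact le_max_left _ _)]
    have hcongr : ∫ x in (-S)..S, deriv G x * w x = ∫ x in (-S)..S, g x * w x := by
      refine intervalIntegral.integral_congr_ae ?_
      filter_upwards [_root_.LocallyIntegrable.ae_hasDerivAt_integral hg] with x hx _
      rw [hG, (hx 0).deriv]
    rw [hcongr]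
    ring
  obtain ⟨c, hc⟩ := ae_eq_const_of_integral_mul_deriv
    (hf.sub hGc.locallyIntegrable) (fun w hw => by
      have h1 : ∫ x, (f - G) x * deriv w x
          = (∫ x, f x * deriv w x) - ∫ x, G x * deriv w x := by
        rw [← integral_sub (hw.deriv.integrable_mul hf)
          (hw.deriv.integrable_mul hGc.locallyIntegrable)]
        congr 1
        ext x
        rw [Pi.sub_apply]
        ring
      rw [h1, h w hw, hibp w hw, sub_self])
  refine ⟨c, ?_⟩
  filter_upwards [hc] with x hx
  rw [Pi.sub_apply] at hx
  linarith

theorem MemL2Loc.locallyIntegrable {f : ℝ → ℝ} (hf : MemL2Loc f) : LocallyIntegrable f := by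
  refine (locallyIntegrable_iff).2 fun K hK => ?_
  have : IsFiniteMeasure (volume.restrict K) := ⟨by simpa using hK.measure_lt_top⟩
  exact (hf K hK).integrable (by norm_num)

theorem locallyIntegrable_continuous_mul {f b : ℝ → ℝ} (hf : LocallyIntegrable f)
    (hb : Continuous b) : LocallyIntegrable fun x => b x * f x := by
  refine (locallyIntegrable_iff).2 fun K hK => ?_
  exact (hf.integrableOn_isCompact hK).continuousOn_mul hb.continuousOn hK

theorem intervalIntegral_congr_of_ae {f g : ℝ → ℝ} (h : ∀ᵐ x, f x = g x) (a b : ℝ) :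
    ∫ t in a..b, f t = ∫ t in a..b, g t :=
  intervalIntegral.integral_congr_ae (h.mono fun _ hx _ => hx)

theorem hasDerivAt_add_primitive {g : ℝ → ℝ} (hg : Continuous g) (c x : ℝ) :
    HasDerivAt (fun x => c + ∫ t in (0 : ℝ)..x, g t) (g x) x :=
  (intervalIntegral.integral_hasDerivAt_right (hg.intervalIntegrable _ _)
    (hg.stronglyMeasurableAtFilter _ _) hg.continuousAt).const_add c

/-! ### Weak solutions are profiles -/

/-- The friction constant `(p+3)/(p-1) - d + 1` in the drift and in the weight. -/
def friction (d : ℕ) (p : ℝ) : ℝ := (p + 3) / (p - 1) - (d : ℝ) + 1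

theorem weight_eq (d : ℕ) (p : ℝ) : weight d p = expWeight (friction d p) := rfl

theorem weight_pos (d : ℕ) (p ζ : ℝ) : 0 < weight d p ζ := Real.exp_pos _

theorem driftCoeff_eq (d : ℕ) (p ζ : ℝ) :
    driftCoeff d p ζ = Real.exp (2 * ζ) / 2 - friction d p := by
  unfold driftCoeff friction; ring

/-- Regularity of bounded weak solutions: two applications of the fundamental theorem of calculus
turn the weak formulation into the first order system. -/
theorem IsWeakSolution.exists_isFlow {d : ℕ} {p : ℝ} (hp : 1 < p) {φ : ℝ → ℝ}
    (h : IsWeakSolution d p φ) (hb : ∀ᵐ ζ, 0 ≤ φ ζ ∧ φ ζ ≤ 1) :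
    ∃ Φ M : ℝ → ℝ, IsFlow (friction d p) (reactionCoeff d p) p Φ M ∧ (∀ᵐ ζ, φ ζ = Φ ζ) ∧
      ∀ ζ, 0 ≤ Φ ζ ∧ Φ ζ ≤ 1 := by
  obtain ⟨g, hφ2, hg2, hweak, heq⟩ := h
  set κ := reactionCoeff d p with hκ
  have hφl := hφ2.locallyIntegrable
  have hgl := hg2.locallyIntegrable
  have hbc : Continuous (driftCoeff d p) := by unfold driftCoeff; fun_prop
  have hpl : LocallyIntegrable fun ζ => φ ζ ^ p := by
    refine (continuous_const (y := (1 : ℝ))).locallyIntegrable.mono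
      (hφl.aestronglyMeasurable.aemeasurable.pow_const p).aestronglyMeasurable ?_
    filter_upwards [hb] with ζ hζ
    rw [Real.norm_eq_abs, abs_of_nonneg (Real.rpow_nonneg hζ.1 p), norm_one]
    exact Real.rpow_le_one hζ.1 hζ.2 (by linarith)
  set r : ℝ → ℝ := fun ζ => -(driftCoeff d p ζ * g ζ + κ * (φ ζ - φ ζ ^ p)) with hr
  have hbg := locallyIntegrable_continuous_mul hgl hbc
  have hκl : LocallyIntegrable fun ζ => κ * (φ ζ - φ ζ ^ p) :=
    locallyIntegrable_continuous_mul (hφl.sub hpl) continuous_const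
  have hrl : LocallyIntegrable r := (hbg.add hκl).neg
  have hweak2 : IsWeakDeriv g r := fun w hw => by
    have h1 := heq w hw
    have h2 : ∀ ζ, -(g ζ * deriv w ζ) + driftCoeff d p ζ * g ζ * w ζ + κ * (φ ζ - φ ζ ^ p) * w ζ
        = -(g ζ * deriv w ζ) - r ζ * w ζ := fun ζ => by rw [hr]; ring
    simp_rw [h2] at h1
    rw [integral_sub (f := fun ζ => -(g ζ * deriv w ζ)) (hw.deriv.integrable_mul hgl).neg
      (hw.integrable_mul hrl), integral_neg] at h1
    linarith
  obtain ⟨c, hc⟩ := ae_eq_primitive_of_isWeakDeriv hφl hgl hweak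
  obtain ⟨c', hc'⟩ := ae_eq_primitive_of_isWeakDeriv hgl hrl hweak2
  set G : ℝ → ℝ := fun x => c' + ∫ t in (0 : ℝ)..x, r t with hG
  have hGc : Continuous G := continuous_const.add
    (intervalIntegral.continuous_primitive (fun a b =>
      (hrl.integrableOn_isCompact isCompact_uIcc).intervalIntegrable) 0)
  set Φ : ℝ → ℝ := fun x => c + ∫ t in (0 : ℝ)..x, G t with hΦ
  have hφΦ : ∀ᵐ ζ, φ ζ = Φ ζ := by
    filter_upwards [hc] with ζ hζ
    rw [hζ, hΦ, intervalIntegral_congr_of_ae hc']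
  have hΦd : ∀ x, HasDerivAt Φ (G x) x := hasDerivAt_add_primitive hGc c
  have hΦc : Continuous Φ := continuous_iff_continuousAt.2 fun x => (hΦd x).continuousAt
  have hΦb : ∀ ζ, 0 ≤ Φ ζ ∧ Φ ζ ≤ 1 := by
    have hclosed : IsClosed {ζ | 0 ≤ Φ ζ ∧ Φ ζ ≤ 1} :=
      (isClosed_le continuous_const hΦc).inter (isClosed_le hΦc continuous_const)
    have hdense : Dense {ζ | 0 ≤ Φ ζ ∧ Φ ζ ≤ 1} := by
      refine Measure.dense_of_ae (μ := volume) ?_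
      filter_upwards [hb, hφΦ] with ζ h1 h2
      rwa [h2] at h1
    exact fun ζ => (hclosed.closure_eq ▸ hdense.closure_eq ▸ Set.mem_univ ζ :
      ζ ∈ {ζ | 0 ≤ Φ ζ ∧ Φ ζ ≤ 1})
  set H : ℝ → ℝ := fun ζ => -(driftCoeff d p ζ * G ζ + κ * (Φ ζ - Φ ζ ^ p)) with hH
  have hHc : Continuous H := by
    have := hΦc.rpow_const (p := p) (fun x => Or.inr (by linarith))
    fun_prop
  have hrH : ∀ᵐ ζ, r ζ = H ζ := by
    filter_upwards [hφΦ, hc'] with ζ h1 h2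
    rw [hr, hH]
    simp only
    rw [h1, h2]
  have hGeq : G = fun x => c' + ∫ t in (0 : ℝ)..x, H t := funext fun x => by
    rw [hG]
    simp only
    rw [intervalIntegral_congr_of_ae hrH]
  have hGd : ∀ x, HasDerivAt G (H x) x := by
    rw [hGeq]
    exact hasDerivAt_add_primitive hHc c'
  refine ⟨Φ, fun ζ => -(expWeight (friction d p) ζ * G ζ), ⟨fun ζ => ?_, fun ζ => ?_⟩, hφΦ, hΦb⟩
  · refine (hΦd ζ).congr_deriv ?_
    have := (expWeight_pos (friction d p) ζ).ne'
    field_simp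
  · refine ((hasDerivAt_expWeight (friction d p) ζ).mul (hGd ζ)).neg.congr_deriv ?_
    rw [reaction_of_mem (hΦb ζ).1 (hΦb ζ).2]
    simp only [hH, driftCoeff_eq]
    ring

theorem measurable_weight (d : ℕ) (p : ℝ) :
    Measurable fun ζ => ENNReal.ofReal (weight d p ζ) :=
  (continuous_expWeight (friction d p)).measurable.ennreal_ofReal

theorem integrable_weightedMeasure_iff {d : ℕ} {p : ℝ} {f : ℝ → ℝ} :
    Integrable f (weightedMeasure d p) ↔ Integrable fun ζ => weight d p ζ * f ζ := by
  unfold weightedMeasure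
  rw [integrable_withDensity_iff_integrable_smul' (measurable_weight d p)
    (Filter.Eventually.of_forall fun _ => ENNReal.ofReal_lt_top)]
  refine integrable_congr (Filter.Eventually.of_forall fun ζ => ?_)
  simp only [smul_eq_mul]
  rw [ENNReal.toReal_ofReal (weight_pos d p ζ).le]

/-- If `ρ f²` is bounded below by a positive constant on a set of infinite length, then `f` is not
in `L²(μ)`. -/
theorem false_of_le_weight_mul_sq {d : ℕ} {p : ℝ} {f : ℝ → ℝ}
    (hf : MemLp f 2 (weightedMeasure d p)) {s : Set ℝ} (hs : MeasurableSet s)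
    (hvol : volume s = ⊤) {c : ℝ} (hc : 0 < c)
    (hle : ∀ᵐ ζ, ζ ∈ s → c ≤ weight d p ζ * f ζ ^ 2) : False := by
  have h1 := integrable_weightedMeasure_iff.1 hf.integrable_sq
  have h2 : IntegrableOn (fun _ : ℝ => c) s := by
    refine Integrable.mono' (h1.integrableOn (s := s)) aestronglyMeasurable_const ?_
    rw [ae_restrict_iff' hs]
    filter_upwards [hle] with ζ hζ hζs
    rw [Real.norm_eq_abs, abs_of_pos hc]
    exact hζ hζs
  rw [integrableOn_const_iff (by simp), hvol] at h2
  rcases h2 with h2 | h2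
  · exact hc.ne' (by simpa using h2)
  · exact lt_irrefl _ h2

/-- Every admissible profile coincides almost everywhere with a solution of the first order system.
The conditions at `±∞` follow from `φ - η ∈ L²(μ)`, since `ρ ≥ 1` near `-∞` and `ρ ≥ e^{4ζ}` near
`+∞`. -/
theorem IsAdmissibleProfile.exists_isProfile {d : ℕ} {p : ℝ} (hp : 1 < p)
    (hm : 0 ≤ friction d p) {η φ : ℝ → ℝ} (hη : IsCutoff η) (h : IsAdmissibleProfile d p η φ) :
    ∃ Φ M : ℝ → ℝ, IsProfile (friction d p) (reactionCoeff d p) p Φ M ∧ φ =ᵐ[volume] Φ := by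
  obtain ⟨Φ, M, hfl, hae, hb⟩ := h.weak.exists_isFlow hp h.bounds
  obtain ⟨g, hmem, -⟩ := h.mem
  refine ⟨Φ, M, ⟨hfl, hb, fun ε hε z => ?_, fun ε hε z => ?_⟩, hae⟩
  · by_contra! hcon
    refine false_of_le_weight_mul_sq hmem (s := Set.Iic (min z 0)) measurableSet_Iic
      Real.volume_Iic (c := ε ^ 2) (by positivity) ?_
    filter_upwards [hae] with ζ hζ hζs
    have h0 : ζ ≤ 0 := (Set.mem_Iic.1 hζs).trans (min_le_right _ _)
    have h1 := hcon ζ ((Set.mem_Iic.1 hζs).trans (min_le_left _ _))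
    rw [hζ, hη.eq_one ζ h0]
    have hw : 1 ≤ weight d p ζ := by
      rw [weight_eq, expWeight]
      refine Real.one_le_exp ?_
      have h2 := Real.exp_pos (2 * ζ)
      have h3 := mul_nonneg hm (neg_nonneg.2 h0)
      linarith
    have h2 : ε ^ 2 ≤ (Φ ζ - 1) ^ 2 := by nlinarith
    nlinarith [sq_nonneg (Φ ζ - 1)]
  · by_contra! hcon
    obtain ⟨Z, hZ⟩ := eventually_atTop.1
      ((tendsto_exp_div_expWeight_atTop (friction d p) 4).eventually_le_const zero_lt_one)
    refine false_of_le_weight_mul_sq hmem (s := Set.Ici (max (max z 1) Z)) measurableSet_Ici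
      Real.volume_Ici (c := ε ^ 2) (by positivity) ?_
    filter_upwards [hae] with ζ hζ hζs
    have hs : max (max z 1) Z ≤ ζ := hζs
    have h1 : z ≤ ζ := ((le_max_left _ _).trans (le_max_left _ _)).trans hs
    have h2 : 1 ≤ ζ := ((le_max_right _ _).trans (le_max_left _ _)).trans hs
    have h3 := hZ ζ ((le_max_right _ _).trans hs)
    rw [div_le_one (expWeight_pos _ ζ)] at h3
    rw [hζ, hη.eq_zero ζ h2, sub_zero, weight_eq]
    have h4 := hcon ζ h1
    have h5 : (ε * Real.exp (-(2 * ζ))) ^ 2 ≤ Φ ζ ^ 2 :=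
      pow_le_pow_left₀ (by positivity) h4 2
    have h6 : Real.exp (4 * ζ) * (Real.exp (-(2 * ζ))) ^ 2 = 1 := by
      rw [sq, ← Real.exp_add, ← Real.exp_add]
      ring_nf
      exact Real.exp_zero
    calc ε ^ 2 = Real.exp (4 * ζ) * (ε * Real.exp (-(2 * ζ))) ^ 2 := by
          linear_combination -ε ^ 2 * h6
      _ ≤ expWeight (friction d p) ζ * Φ ζ ^ 2 := by
          gcongr
          exact (expWeight_pos _ ζ).le

/-! ### Profiles are admissible -/

theorem memL2Loc_of_continuous {f : ℝ → ℝ} (hf : Continuous f) : MemL2Loc f := fun K hK => by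
  have : IsFiniteMeasure (volume.restrict K) := ⟨by simpa using hK.measure_lt_top⟩
  obtain ⟨C, hC⟩ := hK.exists_bound_of_continuousOn hf.continuousOn
  refine MemLp.of_bound hf.aestronglyMeasurable C ?_
  exact (ae_restrict_iff' hK.measurableSet).2 (Filter.Eventually.of_forall hC)

theorem isWeakDeriv_of_hasDerivAt {f f' : ℝ → ℝ} (hf : ∀ x, HasDerivAt f (f' x) x)
    (hf' : Continuous f') : IsWeakDeriv f f' := fun w hw => by
  have hfc : Continuous f := continuous_iff_continuousAt.2 fun x => (hf x).continuousAt
  exact integral_mul_deriv_eq_deriv_mul_of_integrable (fun x _ => hf x) (fun x _ => hw.hasDerivAt x)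
    (hw.deriv.integrable_mul hfc.locallyIntegrable) (hw.integrable_mul hf'.locallyIntegrable)
    (hw.integrable_mul hfc.locallyIntegrable)

theorem IsProfile.isWeakSolution {d : ℕ} {p : ℝ} {φ M : ℝ → ℝ}
    (h : IsProfile (friction d p) (reactionCoeff d p) p φ M) (hp : 1 ≤ p) :
    IsWeakSolution d p φ := by
  have hsm := h.contDiff hp
  have hsm' : ContDiff ℝ ∞ (deriv φ) := (contDiff_infty_iff_deriv.1 hsm).2
  have hsm'' : ContDiff ℝ ∞ (deriv (deriv φ)) := (contDiff_infty_iff_deriv.1 hsm').2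
  have hd' : ∀ x, HasDerivAt (deriv φ) (deriv (deriv φ) x) x := fun x =>
    (hsm'.differentiable (by simp) x).hasDerivAt
  refine ⟨deriv φ, memL2Loc_of_continuous hsm.continuous, memL2Loc_of_continuous hsm'.continuous,
    isWeakDeriv_of_hasDerivAt (fun x => (hsm.differentiable (by simp) x).hasDerivAt)
      hsm'.continuous, fun w hw => ?_⟩
  have h1 : ∀ ζ, -(deriv φ ζ * deriv w ζ) + driftCoeff d p ζ * deriv φ ζ * w ζ
      + reactionCoeff d p * (φ ζ - φ ζ ^ p) * w ζ
      = -(deriv φ ζ * deriv w ζ) - deriv (deriv φ) ζ * w ζ := fun ζ => by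
    rw [driftCoeff_eq]
    linear_combination w ζ * h.deriv_deriv ζ
  simp_rw [h1]
  rw [integral_sub (f := fun ζ => -(deriv φ ζ * deriv w ζ))
    (hw.deriv.integrable_mul hsm'.continuous.locallyIntegrable).neg
    (hw.integrable_mul hsm''.continuous.locallyIntegrable), integral_neg,
    isWeakDeriv_of_hasDerivAt hd' hsm''.continuous w hw]
  ring

theorem integrable_inv_expWeight {m : ℝ} (hm : 0 < m) :
    Integrable fun ζ => (expWeight m ζ)⁻¹ := by
  have hc : Continuous fun ζ => (expWeight m ζ)⁻¹ :=
    (continuous_expWeight m).inv₀ fun ζ => (expWeight_pos m ζ).ne'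
  rw [← integrableOn_univ, ← Set.Iic_union_Ioi (a := (0 : ℝ))]
  refine IntegrableOn.union ?_ ?_
  · refine Integrable.mono' (integrableOn_exp_mul_Iic hm 0) hc.aestronglyMeasurable ?_
    refine Filter.Eventually.of_forall fun ζ => ?_
    rw [Real.norm_eq_abs, abs_of_pos (inv_pos.2 (expWeight_pos m ζ))]
    exact inv_expWeight_le_exp m ζ
  · refine integrable_of_isBigO_exp_neg one_pos hc.continuousOn ?_
    refine Asymptotics.IsBigO.of_bound 1 ?_
    filter_upwards [(tendsto_exp_div_expWeight_atTop m 1).eventually_le_const one_pos] with ζ hζ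
    rw [Real.norm_eq_abs, Real.norm_eq_abs, abs_of_pos (inv_pos.2 (expWeight_pos m ζ)),
      abs_of_pos (Real.exp_pos _), one_mul]
    have h1 : Real.exp (-1 * ζ) * Real.exp (1 * ζ) = 1 := by
      rw [← Real.exp_add]; simp
    calc (expWeight m ζ)⁻¹ = Real.exp (-1 * ζ) * (Real.exp (1 * ζ) / expWeight m ζ) := by
          rw [mul_div_assoc', h1, one_div]
      _ ≤ Real.exp (-1 * ζ) * 1 := by gcongr
      _ = _ := mul_one _

/-- Functions dominated by `1 / ρ` belong to `L²(μ)`, since `1 / ρ` is integrable. -/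
theorem memLp_weightedMeasure {d : ℕ} {p : ℝ} (hm : 0 < friction d p) {f : ℝ → ℝ}
    (hf : Continuous f) {C : ℝ} (hC : ∀ ζ, |f ζ| ≤ C * (weight d p ζ)⁻¹) :
    MemLp f 2 (weightedMeasure d p) := by
  rw [memLp_two_iff_integrable_sq hf.aestronglyMeasurable, integrable_weightedMeasure_iff]
  have hwc : Continuous (weight d p) := continuous_expWeight (friction d p)
  refine Integrable.mono' ((integrable_inv_expWeight hm).const_mul (C ^ 2))
    (hwc.mul (hf.pow 2)).aestronglyMeasurable (Filter.Eventually.of_forall fun ζ => ?_)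
  have hw := weight_pos d p ζ
  rw [Real.norm_eq_abs, abs_of_nonneg (mul_nonneg hw.le (sq_nonneg _)), ← weight_eq, ← sq_abs]
  calc weight d p ζ * |f ζ| ^ 2 ≤ weight d p ζ * (C * (weight d p ζ)⁻¹) ^ 2 := by
        gcongr
        exact hC ζ
    _ = C ^ 2 * (weight d p ζ)⁻¹ := by field_simp

/-- Dominated convergence in `L²`, for sequences that vanish eventually at each point. -/
theorem tendsto_eLpNorm_zero_of_dominated {μ : Measure ℝ} {F : ℕ → ℝ → ℝ} {G : ℝ → ℝ}
    (hF : ∀ n, Continuous (F n)) (hG : MemLp G 2 μ) (hFG : ∀ n x, |F n x| ≤ G x)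
    (h0 : ∀ x, ∀ᶠ n in atTop, F n x = 0) :
    Tendsto (fun n => eLpNorm (F n) 2 μ) atTop (𝓝 0) := by
  have h2 : (2 : ENNReal).toReal = 2 := by norm_num
  have hnorm : ∀ f : ℝ → ℝ, eLpNorm f 2 μ = (∫⁻ x, ‖f x‖ₑ ^ (2 : ℝ) ∂μ) ^ (1 / (2 : ℝ)) :=
    fun f => by rw [eLpNorm_eq_lintegral_rpow_enorm_toReal (by norm_num) (by norm_num), h2]
  have hfin : ∫⁻ x, ‖G x‖ₑ ^ (2 : ℝ) ∂μ ≠ ⊤ := by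
    have := lintegral_rpow_enorm_lt_top_of_eLpNorm_lt_top (p := 2) (by norm_num) (by norm_num)
      hG.eLpNorm_lt_top
    rw [h2] at this
    exact this.ne
  have hlim : Tendsto (fun n => ∫⁻ x, ‖F n x‖ₑ ^ (2 : ℝ) ∂μ) atTop (𝓝 (∫⁻ _, 0 ∂μ)) := by
    refine tendsto_lintegral_of_dominated_convergence (fun x => ‖G x‖ₑ ^ (2 : ℝ))
      (fun n => ((hF n).measurable.enorm.pow_const 2)) (fun n => ?_) hfin ?_
    · refine Filter.Eventually.of_forall fun x => ?_
      refine ENNReal.rpow_le_rpow ?_ (by norm_num)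
      rw [enorm_le_iff_norm_le, Real.norm_eq_abs, Real.norm_eq_abs]
      exact (hFG n x).trans (le_abs_self _)
    · refine Filter.Eventually.of_forall fun x => tendsto_const_nhds.congr' ?_
      filter_upwards [h0 x] with n hn
      rw [hn]
      simp
  simp_rw [hnorm]
  have := (ENNReal.continuous_rpow_const (y := 1 / (2 : ℝ))).tendsto (∫⁻ _ : ℝ, (0 : ENNReal) ∂μ)
  have h3 := this.comp hlim
  simpa [Function.comp_def] using h3

theorem IsCutoff.antitone {η : ℝ → ℝ} (hη : IsCutoff η) : Antitone η :=
  antitone_of_deriv_nonpos (hη.smooth.differentiable (by simp)) hη.deriv_nonpos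

theorem IsCutoff.nonneg {η : ℝ → ℝ} (hη : IsCutoff η) (ζ : ℝ) : 0 ≤ η ζ := by
  have := hη.antitone (le_max_left ζ 1)
  rwa [hη.eq_zero _ (le_max_right ζ 1)] at this

theorem IsCutoff.le_one {η : ℝ → ℝ} (hη : IsCutoff η) (ζ : ℝ) : η ζ ≤ 1 := by
  have := hη.antitone (min_le_left ζ 0)
  rwa [hη.eq_one _ (min_le_right ζ 0)] at this

theorem IsCutoff.deriv_eq_zero_of_neg {η : ℝ → ℝ} (hη : IsCutoff η) {ζ : ℝ} (hζ : ζ < 0) :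
    deriv η ζ = 0 := by
  have : η =ᶠ[𝓝 ζ] fun _ => 1 := by
    filter_upwards [Iio_mem_nhds hζ] with y hy using hη.eq_one y (le_of_lt hy)
  rw [this.deriv_eq, deriv_const]

theorem IsCutoff.deriv_eq_zero_of_one_lt {η : ℝ → ℝ} (hη : IsCutoff η) {ζ : ℝ} (hζ : 1 < ζ) :
    deriv η ζ = 0 := by
  have : η =ᶠ[𝓝 ζ] fun _ => 0 := by
    filter_upwards [Ioi_mem_nhds hζ] with y hy using hη.eq_zero y (le_of_lt hy)
  rw [this.deriv_eq, deriv_const]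

theorem IsCutoff.exists_abs_deriv_le {η : ℝ → ℝ} (hη : IsCutoff η) :
    ∃ D, 0 ≤ D ∧ ∀ ζ, |deriv η ζ| ≤ D := by
  have hc : Continuous (deriv η) := (contDiff_infty_iff_deriv.1 hη.smooth).2.continuous
  obtain ⟨D, hD⟩ := (isCompact_Icc (a := (0 : ℝ)) (b := 1)).exists_bound_of_continuousOn
    hc.continuousOn
  have hD0 : 0 ≤ D := (norm_nonneg _).trans (hD 0 (by simp))
  refine ⟨D, hD0, fun ζ => ?_⟩
  rcases lt_or_ge ζ 0 with h | h
  · rwa [hη.deriv_eq_zero_of_neg h, abs_zero]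
  rcases lt_or_ge 1 ζ with h' | h'
  · rwa [hη.deriv_eq_zero_of_one_lt h', abs_zero]
  exact hD ζ ⟨h, h'⟩

/-- The two-sided cutoff obtained from `η`, equal to `1` on `[-n, n]` and to `0` outside
`[-n - 1, n + 1]`. -/
def twoSidedCutoff (η : ℝ → ℝ) (n ζ : ℝ) : ℝ := η (ζ - n) * η (-ζ - n)

theorem IsCutoff.contDiff_twoSidedCutoff {η : ℝ → ℝ} (hη : IsCutoff η) (n : ℝ) :
    ContDiff ℝ ∞ (twoSidedCutoff η n) := by
  unfold twoSidedCutoff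
  exact (hη.smooth.comp (contDiff_id.sub contDiff_const)).mul
    (hη.smooth.comp (contDiff_id.neg.sub contDiff_const))

theorem IsCutoff.twoSidedCutoff_mem {η : ℝ → ℝ} (hη : IsCutoff η) (n ζ : ℝ) :
    0 ≤ twoSidedCutoff η n ζ ∧ twoSidedCutoff η n ζ ≤ 1 :=
  ⟨mul_nonneg (hη.nonneg _) (hη.nonneg _),
    mul_le_one₀ (hη.le_one _) (hη.nonneg _) (hη.le_one _)⟩

theorem IsCutoff.twoSidedCutoff_eq_one {η : ℝ → ℝ} (hη : IsCutoff η) {n ζ : ℝ} (h : |ζ| ≤ n) :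
    twoSidedCutoff η n ζ = 1 := by
  obtain ⟨h1, h2⟩ := abs_le.1 h
  rw [twoSidedCutoff, hη.eq_one _ (by linarith), hη.eq_one _ (by linarith), one_mul]

theorem IsCutoff.hasCompactSupport_twoSidedCutoff {η : ℝ → ℝ} (hη : IsCutoff η) (n : ℝ) :
    HasCompactSupport (twoSidedCutoff η n) := by
  refine HasCompactSupport.of_support_subset_isCompact
    (isCompact_Icc (a := -(n + 1)) (b := n + 1)) fun ζ hζ => ?_
  by_contra hc
  refine hζ ?_
  rw [Set.mem_Icc, not_and_or, not_le, not_le] at hc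
  rcases hc with hc | hc
  · rw [twoSidedCutoff, hη.eq_zero (-ζ - n) (by linarith), mul_zero]
  · rw [twoSidedCutoff, hη.eq_zero (ζ - n) (by linarith), zero_mul]

theorem IsCutoff.hasDerivAt_twoSidedCutoff {η : ℝ → ℝ} (hη : IsCutoff η) (n ζ : ℝ) :
    HasDerivAt (twoSidedCutoff η n)
      (deriv η (ζ - n) * η (-ζ - n) - η (ζ - n) * deriv η (-ζ - n)) ζ := by
  have hd : ∀ x, HasDerivAt η (deriv η x) x := fun x =>
    (hη.smooth.differentiable (by simp) x).hasDerivAt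
  have h1 : HasDerivAt (fun ζ : ℝ => ζ - n) 1 ζ := (hasDerivAt_id ζ).sub_const n
  have h2 : HasDerivAt (fun ζ : ℝ => -ζ - n) (-1) ζ := (hasDerivAt_neg ζ).sub_const n
  refine (((hd _).comp ζ h1).mul ((hd _).comp ζ h2)).congr_deriv ?_
  simp only [Function.comp]
  ring

theorem IsCutoff.abs_deriv_twoSidedCutoff_le {η : ℝ → ℝ} (hη : IsCutoff η) {D : ℝ}
    (hD : ∀ ζ, |deriv η ζ| ≤ D) (n ζ : ℝ) :
    |deriv (twoSidedCutoff η n) ζ| ≤ 2 * D := by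
  have hD0 : 0 ≤ D := (abs_nonneg _).trans (hD 0)
  rw [(hη.hasDerivAt_twoSidedCutoff n ζ).deriv]
  refine (abs_sub _ _).trans ?_
  rw [abs_mul, abs_mul, abs_of_nonneg (hη.nonneg _), abs_of_nonneg (hη.nonneg _)]
  have h1 := mul_le_mul (hD (ζ - n)) (hη.le_one (-ζ - n)) (hη.nonneg _) hD0
  have h2 := mul_le_mul (hη.le_one (ζ - n)) (hD (-ζ - n)) (abs_nonneg _) zero_le_one
  linarith

theorem IsCutoff.deriv_twoSidedCutoff_eq_zero {η : ℝ → ℝ} (hη : IsCutoff η) {n ζ : ℝ}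
    (h : |ζ| < n) :
    deriv (twoSidedCutoff η n) ζ = 0 := by
  obtain ⟨h1, h2⟩ := abs_lt.1 h
  rw [(hη.hasDerivAt_twoSidedCutoff n ζ).deriv, hη.deriv_eq_zero_of_neg (by linarith),
    hη.deriv_eq_zero_of_neg (by linarith)]
  ring

/-- A smooth function dominated, with its derivative, by `1 / ρ` is a limit of test functions in
`H¹(μ)`: cut it off on larger and larger intervals. -/
theorem memWeightedH1_of_le {d : ℕ} {p : ℝ} (hm : 0 < friction d p) {η : ℝ → ℝ}
    (hη : IsCutoff η) {w : ℝ → ℝ} (hw : ContDiff ℝ ∞ w) {C : ℝ}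
    (h0 : ∀ ζ, |w ζ| ≤ C * (weight d p ζ)⁻¹) (h1 : ∀ ζ, |deriv w ζ| ≤ C * (weight d p ζ)⁻¹) :
    MemWeightedH1 (weightedMeasure d p) w := by
  have hw' : Continuous (deriv w) := (contDiff_infty_iff_deriv.1 hw).2.continuous
  have hwd : ∀ x, HasDerivAt w (deriv w x) x := fun x =>
    (hw.differentiable (by simp) x).hasDerivAt
  obtain ⟨D, hD0, hD⟩ := hη.exists_abs_deriv_le
  have hwc : Continuous fun ζ => (weight d p ζ)⁻¹ :=
    (continuous_expWeight (friction d p)).inv₀ fun ζ => (weight_pos d p ζ).ne'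
  have hC0 : ∀ ζ, 0 ≤ C * (weight d p ζ)⁻¹ := fun ζ => (abs_nonneg _).trans (h0 ζ)
  have hdom : ∀ A, 0 ≤ A → MemLp (fun ζ => A * (C * (weight d p ζ)⁻¹)) 2 (weightedMeasure d p) :=
    fun A hA => memLp_weightedMeasure hm (continuous_const.mul (continuous_const.mul hwc))
      (C := A * C) fun ζ => by rw [abs_of_nonneg (mul_nonneg hA (hC0 ζ)), mul_assoc]
  have hχ : ∀ n : ℕ, ContDiff ℝ ∞ (twoSidedCutoff η n) := fun n => hη.contDiff_twoSidedCutoff n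
  have htest : ∀ n : ℕ, IsTest (fun ζ => twoSidedCutoff η n ζ * w ζ) := fun n =>
    ⟨(hχ n).mul hw, (hη.hasCompactSupport_twoSidedCutoff n).mul_right⟩
  have hlarge : ∀ ζ : ℝ, ∀ᶠ n : ℕ in atTop, |ζ| < n := fun ζ =>
    tendsto_natCast_atTop_atTop.eventually_gt_atTop _
  have hd : ∀ (n : ℕ) ζ, deriv (fun ζ => twoSidedCutoff η n ζ * w ζ) ζ
      = deriv (twoSidedCutoff η n) ζ * w ζ + twoSidedCutoff η n ζ * deriv w ζ := fun n ζ =>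
    (((hη.hasDerivAt_twoSidedCutoff n ζ).differentiableAt.hasDerivAt).mul (hwd ζ)).deriv
  refine ⟨deriv w, memLp_weightedMeasure hm hw.continuous h0, memLp_weightedMeasure hm hw' h1,
    fun n ζ => twoSidedCutoff η n ζ * w ζ, htest, ?_, ?_⟩
  · refine tendsto_eLpNorm_zero_of_dominated (fun n => (htest n).continuous.sub hw.continuous)
      (hdom 1 zero_le_one) (fun n ζ => ?_) fun ζ => ?_
    · obtain ⟨c0, c1⟩ := hη.twoSidedCutoff_mem n ζ
      have : twoSidedCutoff η n ζ * w ζ - w ζ = -((1 - twoSidedCutoff η n ζ) * w ζ) := by ring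
      rw [this, abs_neg, abs_mul, abs_of_nonneg (by linarith)]
      exact mul_le_mul (by linarith) (h0 ζ) (abs_nonneg _) zero_le_one
    · filter_upwards [hlarge ζ] with n hn
      rw [hη.twoSidedCutoff_eq_one hn.le]
      ring
  · refine tendsto_eLpNorm_zero_of_dominated (fun n => (htest n).deriv.continuous.sub hw')
      (hdom (2 * D + 1) (by positivity)) (fun n ζ => ?_) fun ζ => ?_
    · obtain ⟨c0, c1⟩ := hη.twoSidedCutoff_mem n ζ
      have : deriv (fun ζ => twoSidedCutoff η n ζ * w ζ) ζ - deriv w ζ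
          = deriv (twoSidedCutoff η n) ζ * w ζ - (1 - twoSidedCutoff η n ζ) * deriv w ζ := by
        rw [hd]; ring
      rw [this]
      refine (abs_sub _ _).trans ?_
      rw [abs_mul, abs_mul, abs_of_nonneg (show 0 ≤ 1 - twoSidedCutoff η n ζ by linarith), add_mul]
      exact add_le_add
        (mul_le_mul (hη.abs_deriv_twoSidedCutoff_le hD n ζ) (h0 ζ) (abs_nonneg _) (by positivity))
        (mul_le_mul (by linarith) (h1 ζ) (abs_nonneg _) zero_le_one)
    · filter_upwards [hlarge ζ] with n hn
      rw [hd, hη.twoSidedCutoff_eq_one hn.le, hη.deriv_twoSidedCutoff_eq_zero hn]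
      ring

/-- By `exists_bounds`, `φ - η` and its derivative are dominated by `1 / ρ`; on `[0, 1]`, where `η`
is not constant, the weight is bounded. -/
theorem IsProfile.isAdmissibleProfile {d : ℕ} {p : ℝ} {φ M : ℝ → ℝ}
    (h : IsProfile (friction d p) (reactionCoeff d p) p φ M) (hκ : 0 < reactionCoeff d p)
    (hp : 1 < p) (hm : 0 < friction d p) {η : ℝ → ℝ} (hη : IsCutoff η) :
    IsAdmissibleProfile d p η φ := by
  refine ⟨h.isWeakSolution hp.le, ?_, Filter.Eventually.of_forall h.mem⟩
  obtain ⟨C, hleft, hright, hderiv⟩ := h.exists_bounds hκ hp hm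
  obtain ⟨D, hD0, hD⟩ := hη.exists_abs_deriv_le
  have hsm := h.contDiff hp.le
  set B := weightBound (friction d p) 1
  have hB0 : 0 < B := Real.exp_pos _
  have hw0 : ∀ ζ, 0 < (weight d p ζ)⁻¹ := fun ζ => inv_pos.2 (weight_pos d p ζ)
  have hmid : ∀ ζ, 0 ≤ ζ → ζ ≤ 1 → 1 ≤ B * (weight d p ζ)⁻¹ := fun ζ h0 h1 => by
    rw [← div_eq_mul_inv, le_div_iff₀ (weight_pos d p ζ), one_mul]
    exact expWeight_le_weightBound (abs_le.2 ⟨by linarith, h1⟩)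
  have hC0 : 0 ≤ C := by
    have := (abs_nonneg _).trans (hderiv 0)
    exact nonneg_of_mul_nonneg_left this (inv_pos.2 (expWeight_pos _ 0))
  have hle : ∀ A, A ≤ C + B + D * B → ∀ ζ, A * (weight d p ζ)⁻¹
      ≤ (C + B + D * B) * (weight d p ζ)⁻¹ := fun A hA ζ =>
    mul_le_mul_of_nonneg_right hA (hw0 ζ).le
  have hDB : 0 ≤ D * B := mul_nonneg hD0 hB0.le
  refine memWeightedH1_of_le hm hη (hsm.sub hη.smooth) (C := C + B + D * B) (fun ζ => ?_)
    fun ζ => ?_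
  · obtain ⟨b0, b1⟩ := h.mem ζ
    rcases le_total ζ 0 with hζ | hζ
    · rw [hη.eq_one ζ hζ, abs_sub_comm, abs_of_nonneg (by linarith)]
      exact (hleft ζ hζ).trans (hle C (by linarith) ζ)
    rcases le_total 1 ζ with hζ' | hζ'
    · rw [hη.eq_zero ζ hζ', sub_zero, abs_of_nonneg b0]
      exact (hright ζ hζ).trans (hle C (by linarith) ζ)
    · refine le_trans ?_ ((hmid ζ hζ hζ').trans (hle B (by linarith) ζ))
      rw [abs_le]
      constructor <;> linarith [hη.nonneg ζ, hη.le_one ζ]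
  · have hd : deriv (fun ζ => φ ζ - η ζ) ζ = deriv φ ζ - deriv η ζ :=
      deriv_fun_sub (hsm.differentiable (by simp) ζ) (hη.smooth.differentiable (by simp) ζ)
    rw [hd]
    refine (abs_sub _ _).trans ?_
    have hη' : |deriv η ζ| ≤ D * B * (weight d p ζ)⁻¹ := by
      rcases lt_or_ge ζ 0 with hζ | hζ
      · rw [hη.deriv_eq_zero_of_neg hζ, abs_zero]
        exact mul_nonneg hDB (hw0 ζ).le
      rcases lt_or_ge 1 ζ with hζ' | hζ'
      · rw [hη.deriv_eq_zero_of_one_lt hζ', abs_zero]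
        exact mul_nonneg hDB (hw0 ζ).le
      · rw [mul_assoc]
        exact (hD ζ).trans (le_mul_of_one_le_right hD0 (hmid ζ hζ hζ'))
    have := hderiv ζ
    rw [← weight_eq] at this
    have h3 := mul_nonneg hB0.le (hw0 ζ).le
    linarith

/-! ### The self-similar solution -/

/-- The Laplacian of a radial function, written as a function of the squared norm. -/
theorem laplacian_comp_norm_sq {d : ℕ} {G G' : ℝ → ℝ} {G'' : ℝ}
    {x : EuclideanSpace ℝ (Fin d)} (hx : x ≠ 0) (hG : ∀ s, 0 < s → HasDerivAt G (G' s) s)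
    (hG' : HasDerivAt G' G'' (‖x‖ ^ 2)) :
    (Δ (fun y : EuclideanSpace ℝ (Fin d) => G (‖y‖ ^ 2))) x
      = 4 * ‖x‖ ^ 2 * G'' + 2 * d * G' (‖x‖ ^ 2) := by
  have hsq : ∀ y : EuclideanSpace ℝ (Fin d),
      HasFDerivAt (fun y : EuclideanSpace ℝ (Fin d) => ‖y‖ ^ 2) (2 • innerSL ℝ y) y := fun y =>
    (hasStrictFDerivAt_norm_sq y).hasFDerivAt
  have h1 : ∀ y : EuclideanSpace ℝ (Fin d), y ≠ 0 →
      HasFDerivAt (fun y : EuclideanSpace ℝ (Fin d) => G (‖y‖ ^ 2))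
        (G' (‖y‖ ^ 2) • (2 • innerSL ℝ y)) y := fun y hy =>
    (hG _ (by positivity)).comp_hasFDerivAt y (hsq y)
  have h2 : fderiv ℝ (fun y : EuclideanSpace ℝ (Fin d) => G (‖y‖ ^ 2))
      =ᶠ[𝓝 x] fun y => G' (‖y‖ ^ 2) • (2 • innerSL ℝ y) := by
    filter_upwards [isOpen_ne.mem_nhds hx] with y hy using (h1 y hy).fderiv
  have h3 : HasFDerivAt (fun y : EuclideanSpace ℝ (Fin d) => 2 • innerSL ℝ y)
      (2 • innerSL ℝ : EuclideanSpace ℝ (Fin d) →L[ℝ] EuclideanSpace ℝ (Fin d) →L[ℝ] ℝ) x :=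
    (2 • innerSL ℝ : EuclideanSpace ℝ (Fin d) →L[ℝ]
      EuclideanSpace ℝ (Fin d) →L[ℝ] ℝ).hasFDerivAt
  have h4 := (hG'.comp_hasFDerivAt x (hsq x)).smul h3
  have h5 := h4.congr_of_eventuallyEq h2
  rw [InnerProductSpace.laplacian_eq_iteratedFDeriv_orthonormalBasis _
    (EuclideanSpace.basisFun (Fin d) ℝ)]
  simp only [iteratedFDeriv_two_apply, h5.fderiv]
  have h6 : ∀ v : EuclideanSpace ℝ (Fin d),
      (G' (‖x‖ ^ 2) • (2 • innerSL ℝ : EuclideanSpace ℝ (Fin d) →L[ℝ]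
        EuclideanSpace ℝ (Fin d) →L[ℝ] ℝ)
        + (G'' • (2 • innerSL ℝ x)).smulRight (2 • innerSL ℝ x)) v v
      = 2 * G' (‖x‖ ^ 2) * ‖v‖ ^ 2 + 4 * G'' * ‖inner ℝ x v‖ ^ 2 := fun v => by
    have : innerSL ℝ v v = ‖v‖ ^ 2 := real_inner_self_eq_norm_sq v
    simp [this]
    ring
  have h7 : ∀ i, (![EuclideanSpace.basisFun (Fin d) ℝ i, EuclideanSpace.basisFun (Fin d) ℝ i] 0)
      = EuclideanSpace.basisFun (Fin d) ℝ i := fun i => rfl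
  have h8 : ∀ i, (![EuclideanSpace.basisFun (Fin d) ℝ i, EuclideanSpace.basisFun (Fin d) ℝ i] 1)
      = EuclideanSpace.basisFun (Fin d) ℝ i := fun i => rfl
  simp only [h7, h8, Function.comp_apply, h6]
  rw [Finset.sum_add_distrib, ← Finset.mul_sum, ← Finset.mul_sum,
    OrthonormalBasis.sum_sq_norm_inner_left]
  simp only [OrthonormalBasis.norm_eq_one, one_pow, Finset.sum_const, Finset.card_univ,
    Fintype.card_fin, nsmul_eq_mul, mul_one]
  ring

/-- The Laplacian of a radial function in the logarithmic variable `log ‖x‖`. -/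
theorem laplacian_comp_log_norm {d : ℕ} {g g' : ℝ → ℝ} {g'' : ℝ}
    {x : EuclideanSpace ℝ (Fin d)} (hx : x ≠ 0) (hg : ∀ s, HasDerivAt g (g' s) s)
    (hg' : HasDerivAt g' g'' (Real.log ‖x‖)) :
    (Δ (fun y : EuclideanSpace ℝ (Fin d) => g (Real.log ‖y‖))) x
      = (g'' + ((d : ℝ) - 2) * g' (Real.log ‖x‖)) / ‖x‖ ^ 2 := by
  have hn : 0 < ‖x‖ := norm_pos_iff.2 hx
  have hlog : ∀ y : EuclideanSpace ℝ (Fin d), Real.log (‖y‖ ^ 2) / 2 = Real.log ‖y‖ := fun y => by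
    rw [Real.log_pow]; push_cast; ring
  have hl : ∀ s : ℝ, 0 < s → HasDerivAt (fun s => Real.log s / 2) (s⁻¹ / 2) s := fun s hs =>
    (Real.hasDerivAt_log hs.ne').div_const 2
  have h1 : ∀ s : ℝ, 0 < s → HasDerivAt (fun s => g (Real.log s / 2))
      (g' (Real.log s / 2) * (s⁻¹ / 2)) s := fun s hs => (hg _).comp s (hl s hs)
  have hs : 0 < ‖x‖ ^ 2 := by positivity
  have h2 : HasDerivAt (fun s => g' (Real.log s / 2) * (s⁻¹ / 2))
      (g'' * ((‖x‖ ^ 2)⁻¹ / 2) * ((‖x‖ ^ 2)⁻¹ / 2)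
        + g' (Real.log ‖x‖) * (-((‖x‖ ^ 2) ^ 2)⁻¹ / 2)) (‖x‖ ^ 2) := by
    have h3 : HasDerivAt (fun s => g' (Real.log s / 2)) (g'' * ((‖x‖ ^ 2)⁻¹ / 2)) (‖x‖ ^ 2) := by
      refine HasDerivAt.comp (‖x‖ ^ 2) ?_ (hl _ hs)
      rwa [hlog]
    refine (h3.mul ((hasDerivAt_inv hs.ne').div_const 2)).congr_deriv ?_
    rw [hlog]
  have h4 := laplacian_comp_norm_sq hx h1 h2
  simp only [hlog] at h4
  rw [h4]
  field_simp
  ring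

/-- Subcriticality without division, uniformly in `d ≥ 2`. -/
theorem serrin_bound {d : ℕ} (hd : 2 ≤ d) {p : ℝ} (hpd : (p : EReal) < serrinExponent d) :
    ((d : ℝ) - 2) * (p - 1) < 2 := by
  unfold serrinExponent at hpd
  split_ifs at hpd with h
  · subst h; norm_num
  · have h3 : (3 : ℝ) ≤ d := by exact_mod_cast (show 3 ≤ d by omega)
    rw [EReal.coe_lt_coe_iff, lt_div_iff₀ (by linarith)] at hpd
    linarith

theorem reactionCoeff_pos {d : ℕ} {p : ℝ} (hp : 1 < p) (h : ((d : ℝ) - 2) * (p - 1) < 2) :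
    0 < reactionCoeff d p := by
  have hp1 : 0 < p - 1 := by linarith
  have : reactionCoeff d p = 2 / (p - 1) * ((2 - ((d : ℝ) - 2) * (p - 1)) / (p - 1)) := by
    unfold reactionCoeff
    field_simp
    ring
  rw [this]
  exact mul_pos (div_pos two_pos hp1) (div_pos (by linarith) hp1)

theorem friction_pos {d : ℕ} {p : ℝ} (hp : 1 < p) (h : ((d : ℝ) - 2) * (p - 1) < 2) :
    0 < friction d p := by
  have hp1 : 0 < p - 1 := by linarith
  have : friction d p = (4 - ((d : ℝ) - 2) * (p - 1)) / (p - 1) := by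
    unfold friction
    field_simp
    ring
  rw [this]
  exact div_pos (by linarith) hp1

/-- The constant in front of `|x|^{-2/(p-1)}` in `vInfty d p`, written as a power of the reaction
coefficient, which is the form in which it cancels against the absorption term. -/
def singularConst (d : ℕ) (p : ℝ) : ℝ := reactionCoeff d p ^ (1 / (p - 1))

theorem vInfty_eq {d : ℕ} {p : ℝ} (hp : 1 < p) (x : EuclideanSpace ℝ (Fin d)) :
    vInfty d p x = singularConst d p / ‖x‖ ^ (2 / (p - 1)) := by
  have hp1 : p - 1 ≠ 0 := by linarith
  have : 2 * p / (p - 1) - (d : ℝ) = (p + 1) / (p - 1) - (d : ℝ) + 1 := by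
    field_simp; ring
  rw [vInfty, singularConst, reactionCoeff, this]

theorem vInfty_eq_exp {d : ℕ} {p : ℝ} (hp : 1 < p) {x : EuclideanSpace ℝ (Fin d)} (hx : x ≠ 0) :
    vInfty d p x = singularConst d p * Real.exp (-(2 / (p - 1)) * Real.log ‖x‖) := by
  rw [vInfty_eq hp, Real.rpow_def_of_pos (norm_pos_iff.2 hx), div_eq_mul_inv, ← Real.exp_neg]
  ring_nf

theorem log_div_sqrt {r t : ℝ} (hr : 0 < r) (ht : 0 < t) :
    Real.log (r / √t) = Real.log r - Real.log t / 2 := by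
  rw [Real.log_div hr.ne' (Real.sqrt_pos.2 ht).ne', Real.log_sqrt ht.le]

/-- The profile equation is the equation `U_t = ΔU - U^p` in the similarity variable. -/
theorem selfSimilar_equation {d : ℕ} {p : ℝ} (hp : 1 < p) (hκ : 0 < reactionCoeff d p) {φ : ℝ → ℝ}
    (hφ : ContDiff ℝ ∞ φ) (hpos : ∀ ζ, 0 < φ ζ)
    (heq : ∀ ζ, deriv (deriv φ) ζ + driftCoeff d p ζ * deriv φ ζ
      + reactionCoeff d p * (φ ζ - φ ζ ^ p) = 0)
    {x : EuclideanSpace ℝ (Fin d)} (hx : x ≠ 0) {t : ℝ} (ht : 0 < t) :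
    deriv (fun s => vInfty d p x * φ (Real.log (‖x‖ / √s))) t
      = (Δ (fun y : EuclideanSpace ℝ (Fin d) => vInfty d p y * φ (Real.log (‖y‖ / √t)))) x
        - (vInfty d p x * φ (Real.log (‖x‖ / √t))) ^ p := by
  have hp1 : p - 1 ≠ 0 := by linarith
  have hn : 0 < ‖x‖ := norm_pos_iff.2 hx
  have hd1 : ∀ s, HasDerivAt φ (deriv φ s) s := fun s =>
    (hφ.differentiable (by simp) s).hasDerivAt
  have hd2 : ∀ s, HasDerivAt (deriv φ) (deriv (deriv φ) s) s := fun s =>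
    ((contDiff_infty_iff_deriv.1 hφ).2.differentiable (by simp) s).hasDerivAt
  set a := 2 / (p - 1) with ha
  set A := singularConst d p with hA
  set τ := Real.log t / 2 with hτ
  set ℓ := Real.log ‖x‖ with hℓ
  set v := A * Real.exp (-a * ℓ) with hv
  set κ := reactionCoeff d p with hκdef
  -- the time derivative
  have hT : deriv (fun s => vInfty d p x * φ (Real.log (‖x‖ / √s))) t
      = v * (deriv φ (ℓ - τ) * -(t⁻¹ / 2)) := by
    have h1 : (fun s => vInfty d p x * φ (Real.log (‖x‖ / √s)))
        =ᶠ[𝓝 t] fun s => v * φ (ℓ - Real.log s / 2) := by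
      filter_upwards [Ioi_mem_nhds ht] with s hs
      rw [vInfty_eq_exp hp hx, log_div_sqrt hn hs]
    have h2 : HasDerivAt (fun s => ℓ - Real.log s / 2) (-(t⁻¹ / 2)) t :=
      ((Real.hasDerivAt_log ht.ne').div_const 2).const_sub ℓ
    rw [h1.deriv_eq]
    exact (((hd1 (ℓ - τ)).comp t h2).const_mul v).deriv
  -- the Laplacian
  have hexp : ∀ s, HasDerivAt (fun s : ℝ => Real.exp (-a * s)) (-a * Real.exp (-a * s)) s :=
    hasDerivAt_exp_mul (-a)
  have hsub : ∀ s : ℝ, HasDerivAt (fun s => s - τ) 1 s := fun s => (hasDerivAt_id s).sub_const τ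
  have hφ1 : ∀ s, HasDerivAt (fun s => φ (s - τ)) (deriv φ (s - τ)) s := fun s => by
    simpa [Function.comp_def] using (hd1 (s - τ)).comp s (hsub s)
  have hφ2 : ∀ s, HasDerivAt (fun s => deriv φ (s - τ)) (deriv (deriv φ) (s - τ)) s := fun s => by
    simpa [Function.comp_def] using (hd2 (s - τ)).comp s (hsub s)
  have hg1 : ∀ s, HasDerivAt (fun s => A * (Real.exp (-a * s) * φ (s - τ)))
      (A * (Real.exp (-a * s) * (deriv φ (s - τ) - a * φ (s - τ)))) s := fun s =>
    (((hexp s).mul (hφ1 s)).const_mul A).congr_deriv (by ring)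
  have hg2 : HasDerivAt (fun s => A * (Real.exp (-a * s) * (deriv φ (s - τ) - a * φ (s - τ))))
      (v * (deriv (deriv φ) (ℓ - τ) - 2 * a * deriv φ (ℓ - τ) + a ^ 2 * φ (ℓ - τ))) ℓ :=
    (((hexp ℓ).mul ((hφ2 ℓ).sub ((hφ1 ℓ).const_mul a))).const_mul A).congr_deriv
      (by rw [hv, Pi.sub_apply]; ring)
  have hL : (Δ (fun y : EuclideanSpace ℝ (Fin d) => vInfty d p y * φ (Real.log (‖y‖ / √t)))) x
      = (v * (deriv (deriv φ) (ℓ - τ) - 2 * a * deriv φ (ℓ - τ) + a ^ 2 * φ (ℓ - τ))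
        + ((d : ℝ) - 2) * (A * (Real.exp (-a * ℓ) * (deriv φ (ℓ - τ) - a * φ (ℓ - τ)))))
        / ‖x‖ ^ 2 := by
    rw [← laplacian_comp_log_norm hx hg1 hg2]
    refine (InnerProductSpace.laplacian_congr_nhds ?_).self_of_nhds
    filter_upwards [isOpen_ne.mem_nhds hx] with y hy
    rw [vInfty_eq_exp hp hy, log_div_sqrt (norm_pos_iff.2 hy) ht, mul_assoc]
  -- the absorption term
  have hA0 : 0 < A := Real.rpow_pos_of_pos hκ _
  have hAp : A ^ p = A * κ := by
    rw [hA, singularConst, ← Real.rpow_mul hκ.le]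
    have : 1 / (p - 1) * p = 1 / (p - 1) + 1 := by field_simp; ring
    rw [this, Real.rpow_add hκ, Real.rpow_one]
  have hx2 : Real.exp (-(2 * ℓ)) = (‖x‖ ^ 2)⁻¹ := by
    rw [Real.exp_neg, ← Real.exp_log (pow_pos hn 2), Real.log_pow]
    push_cast
    rfl
  have hep : Real.exp (-a * ℓ) ^ p = Real.exp (-a * ℓ) * (‖x‖ ^ 2)⁻¹ := by
    rw [← hx2, ← Real.exp_mul, ← Real.exp_add]
    congr 1
    rw [ha]
    field_simp
    ring
  have hP : (vInfty d p x * φ (Real.log (‖x‖ / √t))) ^ p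
      = v * κ * φ (ℓ - τ) ^ p * (‖x‖ ^ 2)⁻¹ := by
    rw [vInfty_eq_exp hp hx, log_div_sqrt hn ht,
      Real.mul_rpow (mul_pos hA0 (Real.exp_pos _)).le (hpos _).le,
      Real.mul_rpow hA0.le (Real.exp_pos _).le, hAp, hep, hv]
    ring
  -- the coefficients of the profile equation in terms of `a = 2 / (p - 1)`
  have hode := heq (ℓ - τ)
  have he2 : Real.exp (2 * (ℓ - τ)) = ‖x‖ ^ 2 / t := by
    rw [mul_sub, Real.exp_sub, hτ, mul_div_cancel₀ _ (two_ne_zero), Real.exp_log ht]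
    congr 1
    rw [← Real.exp_log (pow_pos hn 2), Real.log_pow]
    push_cast
    rfl
  have hm : friction d p = 2 * a + 2 - d := by
    rw [friction, ha]; field_simp; ring
  have hκa : κ = a * (a + 2 - d) := by
    rw [hκdef, reactionCoeff, ha]; field_simp; ring
  rw [driftCoeff_eq, he2, hm] at hode
  rw [hT, hL, hP]
  have h9 : deriv (deriv φ) (ℓ - τ) = -(‖x‖ ^ 2 / t / 2 - (2 * a + 2 - d)) * deriv φ (ℓ - τ)
      - κ * (φ (ℓ - τ) - φ (ℓ - τ) ^ p) := by linarith
  rw [h9]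
  have h10 : A * (Real.exp (-a * ℓ) * (deriv φ (ℓ - τ) - a * φ (ℓ - τ)))
      = v * (deriv φ (ℓ - τ) - a * φ (ℓ - τ)) := by rw [hv]; ring
  rw [h10, hκa]
  field_simp
  ring

theorem contDiffOn_selfSimilar {d : ℕ} {p : ℝ} (hp : 1 < p) {φ : ℝ → ℝ} (hφ : ContDiff ℝ ∞ φ) :
    ContDiffOn ℝ 2 (fun z : EuclideanSpace ℝ (Fin d) × ℝ =>
      vInfty d p z.1 * φ (Real.log (‖z.1‖ / √z.2))) {z | z.1 ≠ 0 ∧ 0 < z.2} := by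
  intro z hz
  obtain ⟨hx, ht⟩ := hz
  have hn : ‖z.1‖ ≠ 0 := norm_ne_zero_iff.2 hx
  have h1 : ContDiffAt ℝ 2 (fun z : EuclideanSpace ℝ (Fin d) × ℝ => ‖z.1‖) z :=
    contDiffAt_fst.norm ℝ hx
  have h2 : ContDiffAt ℝ 2 (fun z : EuclideanSpace ℝ (Fin d) × ℝ => √z.2) z :=
    contDiffAt_snd.sqrt ht.ne'
  have h3 : ContDiffAt ℝ 2 (fun z : EuclideanSpace ℝ (Fin d) × ℝ =>
      Real.log (‖z.1‖ / √z.2)) z :=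
    (h1.div h2 (Real.sqrt_pos.2 ht).ne').log (div_ne_zero hn (Real.sqrt_pos.2 ht).ne')
  have h4 : ContDiffAt ℝ 2 φ (Real.log (‖z.1‖ / √z.2)) :=
    (contDiff_infty.1 hφ 2).contDiffAt
  simp_rw [vInfty_eq hp]
  exact ((contDiffAt_const.div (h1.rpow_const_of_ne hn)
    (Real.rpow_pos_of_pos (norm_pos_iff.2 hx) _).ne').mul (h4.comp z h3)).contDiffWithinAt

theorem norm_rpow_mul_vInfty {d : ℕ} {p : ℝ} (hp : 1 < p) {x : EuclideanSpace ℝ (Fin d)}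
    (hx : x ≠ 0) (u : ℝ) : ‖x‖ ^ (2 / (p - 1)) * (vInfty d p x * u) = singularConst d p * u := by
  have := (Real.rpow_pos_of_pos (norm_pos_iff.2 hx) (2 / (p - 1))).ne'
  rw [vInfty_eq hp]
  field_simp

theorem isSelfSimilar_vInfty_mul {d : ℕ} {p : ℝ} (hp : 1 < p) (φ : ℝ → ℝ) :
    IsSelfSimilar d p (fun x t => vInfty d p x * φ (Real.log (‖x‖ / √t))) :=
  ⟨fun ζ => singularConst d p * φ ζ, fun _ _ hx _ => norm_rpow_mul_vInfty hp hx _⟩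

theorem isUltraSingular_vInfty_mul {d : ℕ} {p : ℝ} (hp : 1 < p) (hκ : 0 < reactionCoeff d p)
    {φ : ℝ → ℝ} (hφ : ContDiff ℝ ∞ φ) (hpos : ∀ ζ, 0 < φ ζ)
    (heq : ∀ ζ, deriv (deriv φ) ζ + driftCoeff d p ζ * deriv φ ζ
      + reactionCoeff d p * (φ ζ - φ ζ ^ p) = 0)
    (hbot : Tendsto φ atBot (𝓝 1)) (htop : Tendsto φ atTop (𝓝 0)) :
    IsUltraSingular d p (fun x t => vInfty d p x * φ (Real.log (‖x‖ / √t))) where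
  pos x t hx _ := by
    rw [vInfty_eq hp]
    exact mul_pos (div_pos (Real.rpow_pos_of_pos hκ _)
      (Real.rpow_pos_of_pos (norm_pos_iff.2 hx) _)) (hpos _)
  regular := contDiffOn_selfSimilar hp hφ
  equation x t hx ht := selfSimilar_equation hp hκ hφ hpos heq hx ht
  initial x hx := by
    have hn : 0 < ‖x‖ := norm_pos_iff.2 hx
    have h1 : Tendsto (fun t : ℝ => Real.log ‖x‖ - Real.log t / 2) (𝓝[>] 0) atTop := by
      have h2 : Tendsto (fun t : ℝ => -(Real.log t / 2)) (𝓝[>] 0) atTop :=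
        tendsto_neg_atBot_atTop.comp (Real.tendsto_log_nhdsGT_zero.atBot_div_const two_pos)
      exact tendsto_atTop_add_const_left _ _ h2
    have h3 := (htop.comp h1).const_mul (vInfty d p x)
    rw [mul_zero] at h3
    refine h3.congr' ?_
    filter_upwards [self_mem_nhdsWithin] with t ht
    rw [log_div_sqrt hn ht]
    rfl
  singular t ht := by
    refine ⟨singularConst d p, Real.rpow_pos_of_pos hκ _, ?_⟩
    have h1 : Tendsto (fun x : EuclideanSpace ℝ (Fin d) => Real.log (‖x‖ / √t)) (𝓝[≠] 0) atBot := by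
      refine Real.tendsto_log_nhdsGT_zero.comp (tendsto_nhdsWithin_iff.2 ⟨?_, ?_⟩)
      · have : Tendsto (fun x : EuclideanSpace ℝ (Fin d) => ‖x‖ / √t) (𝓝 0)
            (𝓝 (‖(0 : EuclideanSpace ℝ (Fin d))‖ / √t)) :=
          (continuous_norm.div_const _).tendsto 0
        rw [norm_zero, zero_div] at this
        exact this.mono_left nhdsWithin_le_nhds
      · filter_upwards [self_mem_nhdsWithin] with x hx
        exact div_pos (norm_pos_iff.2 hx) (Real.sqrt_pos.2 ht)
    have h3 := (hbot.comp h1).const_mul (singularConst d p)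
    rw [mul_one] at h3
    refine h3.congr' ?_
    filter_upwards [self_mem_nhdsWithin] with x hx
    rw [norm_rpow_mul_vInfty hp hx]
    rfl

end

end UltraSingular

theorem theorem2p2 (d : ℕ) (hd : 2 ≤ d) (p : ℝ) (hp : 1 < p)
    (hpd : (p : EReal) < UltraSingular.serrinExponent d)
    (η : ℝ → ℝ) (hη : UltraSingular.IsCutoff η) :
    ∃ φ : ℝ → ℝ,
      -- existence and uniqueness of the weak solution
      UltraSingular.IsAdmissibleProfile d p η φ ∧
      (∀ ψ : ℝ → ℝ, UltraSingular.IsAdmissibleProfile d p η ψ → ψ =ᵐ[volume] φ) ∧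
      -- regularity, classical equation, strict bounds, monotonicity
      ContDiff ℝ ∞ φ ∧
      (∀ ζ : ℝ, deriv (deriv φ) ζ + UltraSingular.driftCoeff d p ζ * deriv φ ζ
        + UltraSingular.reactionCoeff d p * (φ ζ - φ ζ ^ p) = 0) ∧
      (∀ ζ : ℝ, 0 < φ ζ ∧ φ ζ < 1) ∧
      StrictAnti φ ∧
      -- behavior at infinity
      Tendsto φ atBot (𝓝 1) ∧ Tendsto (deriv φ) atBot (𝓝 0) ∧
      Tendsto φ atTop (𝓝 0) ∧ Tendsto (deriv φ) atTop (𝓝 0) ∧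
      (∃ C : ℝ, 0 < C ∧
        Tendsto (fun ζ : ℝ => φ ζ /
          Real.exp (-(Real.exp (2 * ζ) / 4) + ((5 - p) / (p - 1) - (d : ℝ) + 1) * ζ))
          atTop (𝓝 C)) ∧
      -- the associated ultra-singular self-similar solution
      UltraSingular.IsUltraSingular d p
        (fun x t => UltraSingular.vInfty d p x * φ (Real.log (‖x‖ / √t))) ∧
      UltraSingular.IsSelfSimilar d p
        (fun x t => UltraSingular.vInfty d p x * φ (Real.log (‖x‖ / √t))) := by
  have hs := UltraSingular.serrin_bound hd hpd
  have hκ := UltraSingular.reactionCoeff_pos hp hs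
  have hm := UltraSingular.friction_pos hp hs
  obtain ⟨φ, M, h⟩ := UltraSingular.exists_isProfile hκ.le hp.le hm
  have heq : ∀ ζ : ℝ, deriv (deriv φ) ζ + UltraSingular.driftCoeff d p ζ * deriv φ ζ
      + UltraSingular.reactionCoeff d p * (φ ζ - φ ζ ^ p) = 0 := fun ζ => by
    rw [UltraSingular.driftCoeff_eq]
    exact h.deriv_deriv ζ
  have hbot := h.tendsto_atBot hκ.le hp.le
  have htop := h.tendsto_atTop hκ.le hp.le
  refine ⟨φ, h.isAdmissibleProfile hκ hp hm hη, fun ψ hψ => ?_, h.contDiff hp.le, heq,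
    fun ζ => ⟨h.pos hp.le ζ, h.lt_one hp.le ζ⟩, h.strictAnti hκ hp, hbot,
    h.deriv_tendsto_atBot hκ hp hm, htop, h.deriv_tendsto_atTop hκ hp hm.le, ?_,
    UltraSingular.isUltraSingular_vInfty_mul hp hκ (h.contDiff hp.le) (h.pos hp.le) heq hbot htop,
    UltraSingular.isSelfSimilar_vInfty_mul hp φ⟩
  · obtain ⟨Φ, N, h', hae⟩ := hψ.exists_isProfile hp hm.le hη
    rwa [h.unique h' hκ hp hm]
  · obtain ⟨C, hC, hlim⟩ := h.exists_tendsto_div hκ hp hm.le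
    refine ⟨C, hC, hlim.congr fun ζ => ?_⟩
    have hp1 : p - 1 ≠ 0 := by linarith
    rw [div_eq_mul_inv (Real.exp _), UltraSingular.inv_expWeight, ← Real.exp_add]
    congr 2
    rw [UltraSingular.friction]
    field_simp
    ring
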